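/- **Setting.** Let $S$ be a compact oriented piecewise linear surface, not necessarily connected, with boundary components called holes. A *tangle* $T$ in $S$ is a finite set of unoriented curves in $S$, crossing transversally in double points with under/over information, whose open curves end at distinct points of $\partial S$ and which are otherwise disjoint from $\partial S$. The surface is presented by a cell decomposition (finitely many oriented polygons, some of whose sides are glued in pairs reversing orientation) in which $T$ is a union of edges. A *face* is a connected component of $S\setminus T$. The tangle is *well-placed* if every face $f$ (with the boundary points of $S$ it contains) meets $\partial S$ in a connected, possibly empty, set. The Euler characteristic $\chi_f$ is that of the compact surface obtained by cutting $S$ along $T$ at the component corresponding to $f$ (vertices minus edges plus polygons). The surface is *decorated* by two disjoint, possibly empty, ordered lists of holes, its upper and its lower boundary, where each listed hole carries a marked vertex not on $T$. Let $T$ in $S$ and $T'$ in $S'$ be tangles in decorated surfaces. The lower boundary of $S$ *matches* the upper boundary of $S'$ if the lists have the same length and, numbering the vertices of corresponding holes from the marked ones, along the induced orientation for $S$ and against it for $S'$, the numbers of vertices agree and the tangle endpoints occupy the same positions. Then $T'\circ T$ is the tangle obtained by pasting the lower holes of $S$ to the corresponding upper holes of $S'$ with the marked points aligned; its upper boundary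 is that of $S$ and its lower boundary is that of $S'$. **Evaluation.** Fix a finite set $C$ of symbols, a commutative ring $\mathcal R$, a commutative $\mathcal R$-algebra $\mathcal R^{\sqrt{}}$, invertible elements $x_i\in\mathcal R$ with square roots $\sqrt{x_i}\in\mathcal R^{\sqrt{}}$ $(i\in C)$, elements $x_{ijkl}\in\mathcal R$ with $x_{klij}=x_{ijkl}$, and a set of unordered pairs of symbols called forbidden. A *state* $\sigma$ of $T$ assigns a symbol to each face. Its value is $0$ if the two sides of some edge of $T$ carry a forbidden pair. Otherwise it is the product, over all faces $f$, with symbol $i=\sigma(f)$, of $$x_i^{\chi_f}/\sqrt{x_i}\ \text{ if } f \text{ meets some hole in a part but not all of it,}\qquad x_i^{\chi_f}\ \text{ otherwise,}$$ and, over all crossings, of $x_{ijkl}$, where $i,j,k,l$ are the symbols of the adjacent faces anticlockwise from the east when the overpass is drawn from northeast to southwest. A partial state on the lower (upper) boundary of $T$ assigns symbols to the faces meeting it, and is recorded by the list of symbols along the edges of the lower (upper) holes. Let $\Lambda(T)$ and $\Upsilon(T)$ be the sets of such lists on the lower and upper boundary that are consistent (one symbol per face) and not forbidden (no forbidden pair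 on adjacent faces meeting that boundary). The *evaluation* $[T]$ is the matrix whose $(\lambda,\upsilon)$-entry is the sum of the values of all states of $T$ that extend both $\lambda$ and $\upsilon$; entries at inconsistent or forbidden lists are therefore $0$. **Theorem.** Let $T$ and $T'$ be well-placed tangles in decorated surfaces $S$ and $S'$ such that the lower boundary of $S$ matches the upper boundary of $S'$. Then $T'\circ T$ is a well-placed tangle, $\Lambda(T'\circ T)=\Lambda(T')$, $\Upsilon(T'\circ T)=\Upsilon(T)$, and for all $\lambda\in\Lambda(T')$ and $\upsilon\in\Upsilon(T)$ $$[T'\circ T]_{\lambda,\upsilon}=\sum_{\mu\in\Upsilon(T')\cap\Lambda(T)}[T']_{\lambda,\mu}\,[T]_{\mu,\upsilon}.$$ Also $[T'\circ T]=[T']\,[T]$ as matrices indexed by all lists of symbols. -/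

import Mathlib

/-! Compact oriented surfaces are presented by a cell decomposition, that is, by a finite family of
disjoint oriented polygons some of whose sides are glued in pairs, reversing orientation.
`D` is the set of all sides ("darts"); each dart is directed so that its polygon lies on its left,
so the polygons are traversed anticlockwise. -/

namespace FacialTangle

/-- Polygons with sides `D`: `next` sends each side to the following side of its polygon (the
polygons are the cycles of `next`), and `opp` sends a side to the side glued to it.  The sides fixed
by `opp` are not glued: they make up the boundary of the surface. -/
structure PolygonGluing (D : Type*) where
  next : Equiv.Perm D
  opp : D → D

namespace PolygonGluing

variable {D : Type*} (M : PolygonGluing D)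

/-- `d` is an edge of the boundary of the surface. -/
def IsBoundary (d : D) : Prop := M.opp d = d

/-- Gluing `d` to `opp d` identifies the starting point of `d` with the end of `opp d`, which is the
starting point of `next (opp d)`.  Vertices are classes of starting points of darts. -/
def vertexSetoid : Setoid D :=
  Relation.EqvGen.setoid fun d e => ¬ M.IsBoundary d ∧ e = M.next (M.opp d)

def Vertex : Type _ := Quotient M.vertexSetoid

/-- The starting point of a dart. -/
def tail (d : D) : M.Vertex := Quotient.mk M.vertexSetoid d

/-- The end point of a dart. -/
def head (d : D) : M.Vertex := M.tail (M.next d)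

/-- Darts in the same connected component of the surface. -/
def componentSetoid : Setoid D :=
  Relation.EqvGen.setoid fun d e => e = M.next d ∨ e = M.opp d

/-- The connected components of the surface. -/
def Component : Type _ := Quotient M.componentSetoid

def component (d : D) : M.Component := Quotient.mk M.componentSetoid d

noncomputable instance [Finite D] : Fintype M.Component :=
  haveI : Finite M.Component := Quotient.finite M.componentSetoid
  Fintype.ofFinite _

/-- The Euler characteristic (vertices minus edges plus polygons) of a component. -/
noncomputable def eulerChar (f : M.Component) : ℤ :=
  ((M.tail '' {d | M.component d = f}).ncard : ℤ)
    - (((fun d => s(d, M.opp d)) '' {d | M.component d = f}).ncard : ℤ)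
    + ((Quotient.mk (Equiv.Perm.SameCycle.setoid M.next) '' {d | M.component d = f}).ncard : ℤ)

/-- Two boundary edges on the same hole, i.e. on the same component of the boundary: one is reached
from the other by passing between boundary edges that have a common vertex. -/
def SameHole : D → D → Prop :=
  Relation.EqvGen fun d e => M.IsBoundary d ∧ M.IsBoundary e ∧ M.tail e = M.head d

open Classical in
/-- The surface obtained by cutting along a set of edges. -/
noncomputable def cut (s : Set D) : PolygonGluing D where
  next := M.next
  opp d := if d ∈ s then d else M.opp d

end PolygonGluing

/-- The combinatorial type of an ordered sequence of marked holes: hole `h` is a circle divided into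
`len h + 1` edges, numbered cyclically, edge `j` having the vertices `j` and `j + 1`.  Vertex `0` is
the marked point.  `endpoint` tells which vertices are endpoints of tangle curves. -/
structure BoundaryType where
  holes : ℕ
  len : Fin holes → ℕ
  endpoint : (h : Fin holes) → Fin (len h + 1) → Prop
  mark_avoids : ∀ h, ¬ endpoint h 0

/-- The edges (also, the vertices) of a sequence of marked holes. -/
abbrev BoundaryType.Pos (B : BoundaryType) : Type := Σ h : Fin B.holes, Fin (B.len h + 1)

def BoundaryType.succ (B : BoundaryType) (p : B.Pos) : B.Pos := ⟨p.1, p.2 + 1⟩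

/-- The data of a tangle diagram in a decorated surface.
* `strand` is the set of darts lying on the tangle;
* `overpass` says, for the tangle darts that start at a crossing, whether they lie on the overpass
  (its other values are irrelevant);
* `upper` and `lower` list the edges of the upper and of the lower holes.  Lower edges are numbered
  along the orientation that the surface induces on its boundary, upper edges against it.
The laws are in `IsTangle`. -/
structure DecoratedTangle (U L : BoundaryType) (D : Type*) where
  surface : PolygonGluing D
  strand : Set D
  overpass : Set D
  upper : U.Pos → D
  lower : L.Pos → D

namespace DecoratedTangle

variable {U V L : BoundaryType} {D D' : Type*}

section

variable (T : DecoratedTangle U L D)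

/-- The number of ends of tangle edges at a vertex. -/
noncomputable def degree (v : T.surface.Vertex) : ℕ := {d ∈ T.strand | T.surface.tail d = v}.ncard

/-- The surface cut open along the tangle. -/
noncomputable def cutOpen : PolygonGluing D := T.surface.cut T.strand

/-- The faces are the connected components of the complement of the tangle. -/
abbrev Face : Type _ := T.cutOpen.Component

/-- The face on the left of a dart.  The face on the right of `d` is `face (opp d)`. -/
noncomputable def face (d : D) : T.Face := T.cutOpen.component d

structure IsTangle : Prop where
  /-- Sides are glued in pairs. -/
  opp_opp : ∀ d, T.surface.opp (T.surface.opp d) = d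
  /-- The tangle is a union of edges, none of them in the boundary. -/
  strand_interior : ∀ d ∈ T.strand, ¬ T.surface.IsBoundary d
  strand_opp : ∀ d ∈ T.strand, T.surface.opp d ∈ T.strand
  /-- Curves meet the boundary only at their endpoints, which are distinct. -/
  degree_boundary : ∀ d, T.surface.IsBoundary d → T.degree (T.surface.tail d) ≤ 1
  /-- In the interior, the tangle is locally a curve, or else two curves that cross. -/
  degree_interior : ∀ v, (∀ d, T.surface.IsBoundary d → T.surface.tail d ≠ v) →
    T.degree v = 0 ∨ T.degree v = 2 ∨ T.degree v = 4
  /-- If `e` is the first tangle dart after `d` in anticlockwise order around a crossing, then exactly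
  one of them is on the overpass: the overpass consists of two opposite tangle darts. -/
  over_alternates : ∀ d ∈ T.strand, ∀ e ∈ T.strand, T.degree (T.surface.tail d) = 4 →
    T.cutOpen.tail d = T.cutOpen.head (T.surface.opp e) → (d ∈ T.overpass ↔ e ∉ T.overpass)
  /-- The upper and lower holes are pairwise different. -/
  injective : Function.Injective (Sum.elim T.upper T.lower)
  lower_boundary : ∀ p, T.surface.IsBoundary (T.lower p)
  lower_succ : ∀ p, T.surface.head (T.lower p) = T.surface.tail (T.lower (L.succ p))
  lower_endpoint : ∀ p, L.endpoint p.1 p.2 ↔ ∃ d ∈ T.strand, T.surface.tail d = T.surface.tail (T.lower p)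
  upper_boundary : ∀ p, T.surface.IsBoundary (T.upper p)
  upper_succ : ∀ p, T.surface.head (T.upper (U.succ p)) = T.surface.tail (T.upper p)
  upper_endpoint : ∀ p, U.endpoint p.1 p.2 ↔ ∃ d ∈ T.strand, T.surface.tail d = T.surface.head (T.upper p)

/-- Two boundary edges are in the same component of the boundary minus the tangle: one is reached
from the other by passing between boundary edges that have a common vertex not on the tangle. -/
def SameArc : D → D → Prop :=
  Relation.EqvGen fun d e =>
    T.surface.IsBoundary d ∧ T.surface.IsBoundary e ∧ T.cutOpen.tail e = T.cutOpen.head d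

/-- Every face meets the boundary of the surface in a connected (possibly empty) set. -/
def IsWellPlaced : Prop :=
  ∀ d e, T.surface.IsBoundary d → T.surface.IsBoundary e → T.face d = T.face e → T.SameArc d e

/-- The face `f` meets some hole in a part, but not all of it; equivalently, it has an edge on some
hole that contains an endpoint of the tangle. -/
def MeetsPartOfHole (f : T.Face) : Prop :=
  ∃ d e, T.surface.IsBoundary d ∧ T.surface.SameHole d e ∧ T.face d = f ∧
    ∃ t ∈ T.strand, T.surface.tail t = T.surface.tail e

end

open Classical in
/-- The composite, obtained by pasting the lower holes of `T` to the upper holes of `T'`, in order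
and with marked points aligned. -/
noncomputable def comp (T' : DecoratedTangle V L D') (T : DecoratedTangle U V D) :
    DecoratedTangle U L (D ⊕ D') where
  surface :=
    { next := Equiv.sumCongr T.surface.next T'.surface.next
      opp := Sum.elim
        (fun d => if h : ∃ p, T.lower p = d then Sum.inr (T'.upper h.choose)
          else Sum.inl (T.surface.opp d))
        (fun d => if h : ∃ p, T'.upper p = d then Sum.inl (T.lower h.choose)
          else Sum.inr (T'.surface.opp d)) }
  strand := Sum.inl '' T.strand ∪ Sum.inr '' T'.strand
  overpass := Sum.inl '' T.overpass ∪ Sum.inr '' T'.overpass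
  upper p := Sum.inl (T.upper p)
  lower p := Sum.inr (T'.lower p)

end DecoratedTangle

/-- The variables of a facial state sum with symbols `C`: invertible facial variables `x_i` in a
ring `R`, with square roots in a ring `A` over `R`; crossing variables `x_{ijkl}` in `R`; and a set
of forbidden pairs of symbols. -/
structure FacialVariables (C R A : Type*) [CommRing R] [CommRing A] [Algebra R A] where
  facial : C → Rˣ
  sqrt : C → Aˣ
  sqrt_sq : ∀ i, sqrt i ^ 2 = Units.map (algebraMap R A : R →* A) (facial i)
  crossing : C → C → C → C → R
  crossing_symm : ∀ i j k l, crossing k l i j = crossing i j k l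
  forbidden : Set (Sym2 C)

namespace DecoratedTangle

variable {U L : BoundaryType} {D : Type*} [Fintype D] (T : DecoratedTangle U L D)
variable {C R A : Type*} [CommRing R] [CommRing A] [Algebra R A] (W : FacialVariables C R A)

open Classical in
/-- The contribution of a face with symbol `i`: the power of `x_i` whose exponent is the Euler
characteristic of the face, divided by the square root of `x_i` if the face meets a hole in part but
not all of it. -/
noncomputable def contribution (f : T.Face) (i : C) : A :=
  if T.MeetsPartOfHole f then
    ((Units.map (algebraMap R A : R →* A) (W.facial i) ^ T.cutOpen.eulerChar f / W.sqrt i : Aˣ) : A)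
  else ((Units.map (algebraMap R A : R →* A) (W.facial i) ^ T.cutOpen.eulerChar f : Aˣ) : A)

open Classical in
/-- The crossings, each given by its overpass, as the unordered pair of the two overpass darts that
start at the crossing. -/
noncomputable def crossings : Finset (Sym2 D) :=
  {z | ∃ d e, z = s(d, e) ∧ d ≠ e ∧ T.surface.tail d = T.surface.tail e ∧
    T.degree (T.surface.tail d) = 4 ∧ d ∈ T.strand ∩ T.overpass ∧ e ∈ T.strand ∩ T.overpass}

/-- The crossing variable `x_{ijkl}` of a crossing in the state `σ`.  With the overpass going from
northeast (`d`) to southwest (`e`), the faces on the right and on the left of `d` and those on the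
right and on the left of `e` are the east, north, west and south faces, in this order. -/
noncomputable def crossingValue (σ : T.Face → C) : Sym2 D → R :=
  Sym2.lift ⟨fun d e => W.crossing (σ (T.face (T.surface.opp d))) (σ (T.face d))
    (σ (T.face (T.surface.opp e))) (σ (T.face e)), fun _ _ => (W.crossing_symm _ _ _ _).symm⟩

/-- Some edge of the tangle has a forbidden pair of symbols on its two sides. -/
def IsForbidden (σ : T.Face → C) : Prop :=
  ∃ d ∈ T.strand, s(σ (T.face d), σ (T.face (T.surface.opp d))) ∈ W.forbidden

open Classical in
/-- The value of a state. -/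
noncomputable def stateValue (σ : T.Face → C) : A :=
  if T.IsForbidden W σ then 0
  else (∏ f : T.Face, T.contribution W f (σ f)) *
    algebraMap R A (∏ z ∈ T.crossings, T.crossingValue W σ z)

variable [Fintype C]

open Classical in
/-- The evaluation of `T`.  A partial state on the faces that meet the lower (upper) boundary is
given by listing the symbols next to the successive edges of the lower (upper) holes.  The entry at
`(lam, ups)` is the sum of the values of the states of `T` that extend both `lam` and `ups`; so it
is `0` at lists that are inconsistent or forbidden. -/
noncomputable def evaluation : Matrix (L.Pos → C) (U.Pos → C) A := fun lam ups =>
  ∑ σ : T.Face → C,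
    if (∀ p, σ (T.face (T.lower p)) = lam p) ∧ (∀ p, σ (T.face (T.upper p)) = ups p) then
      T.stateValue W σ
    else 0

/-- `c` assigns symbols consistently to the faces at the edges `b p`, without a forbidden pair on two
adjacent ones of these faces. -/
def IsAdmissible {P : Type*} (b : P → D) (c : P → C) : Prop :=
  (∀ p q, T.face (b p) = T.face (b q) → c p = c q) ∧
  ∀ d ∈ T.strand, ∀ p q, T.face d = T.face (b p) → T.face (T.surface.opp d) = T.face (b q) →
    s(c p, c q) ∉ W.forbidden

open Classical in
/-- The partial states on the lower boundary that are neither inconsistent nor forbidden. -/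
noncomputable def lowerStates : Finset (L.Pos → C) := {c | T.IsAdmissible W T.lower c}

open Classical in
/-- The partial states on the upper boundary that are neither inconsistent nor forbidden. -/
noncomputable def upperStates : Finset (U.Pos → C) := {c | T.IsAdmissible W T.upper c}

end DecoratedTangle

end FacialTangle

/-! Multiplicativity of the facial state sum under the composition of tangles.

Let `T' ∘ T` be pasted from `T` and `T'` along the holes of type `V`.  As both tangles are
well-placed, a face of `T` at a lower hole meets the boundary of the surface in one connected piece:
a whole hole without endpoints, or one of the arcs into which the endpoints divide a hole.  So these
faces correspond to the classes of `V.arcSetoid`, and so do the faces of `T'` at its upper holes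
(`face_lower_eq_iff_face_upper_eq`).  Hence the composite has three kinds of faces: the faces of `T`
not at a lower hole, the faces of `T'` not at an upper hole, and the unions of a face of `T` and a
face of `T'` along one arc or one hole (`comp_face`).  The last ones no longer meet the boundary.
This makes the composite a well-placed tangle, and its states are the pairs of states of `T'` and `T`
that agree along the pasted edges (`sum_states_comp`).

The value of such a state is the product of the values of the pair (`stateValue_comp`).  The tangle
edges and the crossings of the composite are those of `T` and of `T'`.  If a union of two faces is
along a hole, Euler characteristics add up; if it is along an arc, with `k` edges and `k + 1`
vertices, the sum drops by `1`, and the missing factor is provided by the two square roots, as then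
both faces meet their hole in part only (`comp_contribution_glued`).  Summing the products over all
pairs of states, according to their common list of symbols along the pasted edges, gives the matrix
product; lists that are not admissible contribute `0`.

The darts of the pasted surface form a disjoint union, and its vertices, edges, polygons and
components are quotients of it.  Each is described by the same notion, `GluesAlong`: two quotients
are glued along a partial bijection between their classes, and nothing else is identified.  Cutting
along the tangle commutes with pasting (`comp_cutOpen`), so the description applies to the surface
and to the surface cut open. -/

namespace FacialTangle

open Relation

/-! ### Deterministic relations and glued quotients -/

/-- The paths of a deterministic relation are confluent, so either both or none of two equivalent
elements lead to a given terminal element. -/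
theorem reflTransGen_iff_of_eqvGen {X : Type*} {r : X → X → Prop}
    (hr : ∀ x y z, r x y → r x z → y = z) {t : X} (ht : ∀ y, ¬ r t y) {x y : X}
    (h : EqvGen r x y) : ReflTransGen r x t ↔ ReflTransGen r y t := by
  induction h with
  | rel x y h =>
    refine ⟨fun hx => ?_, fun hy => .head h hy⟩
    rcases ReflTransGen.cases_head hx with rfl | ⟨z, hz, hzt⟩
    · exact absurd h (ht _)
    · rwa [hr _ _ _ h hz]
  | refl => rfl
  | symm _ _ _ ih => exact ih.symm
  | trans _ _ _ _ _ ih₁ ih₂ => exact ih₁.trans ih₂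

/-- A class of the equivalence relation generated by a deterministic relation has at most one
terminal element. -/
theorem eq_of_eqvGen_of_terminal {X : Type*} {r : X → X → Prop}
    (hr : ∀ x y z, r x y → r x z → y = z) {s t : X} (hs : ∀ y, ¬ r s y) (ht : ∀ y, ¬ r t y)
    (h : EqvGen r s t) : s = t := by
  rcases ReflTransGen.cases_head ((reflTransGen_iff_of_eqvGen hr ht h).2 .refl) with h | ⟨z, hz, -⟩
  · exact h
  · exact absurd hz (hs z)

/-- If one step of `r` away from the image of `a`, in either direction, leads to a point of the
image whose index has the same value of `φ`, then so does any zigzag of steps. -/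
theorem exists_of_eqvGen {P X Y : Type*} {r : X → X → Prop} (a : P → X) (φ : P → Y)
    (h : ∀ p x, r (a p) x ∨ r x (a p) → ∃ q, x = a q ∧ φ p = φ q) {x y : X} (hxy : EqvGen r x y)
    {p : P} (hp : x = a p) : ∃ q, y = a q ∧ φ p = φ q := by
  suffices H : (∃ q, x = a q ∧ φ p = φ q) ↔ ∃ q, y = a q ∧ φ p = φ q from H.1 ⟨p, hp, rfl⟩
  clear hp
  induction hxy with
  | rel x y hxy =>
    constructor
    · rintro ⟨q, rfl, hq⟩
      obtain ⟨q', hy, hq'⟩ := h q y (.inl hxy)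
      exact ⟨q', hy, hq.trans hq'⟩
    · rintro ⟨q, rfl, hq⟩
      obtain ⟨q', hy, hq'⟩ := h q x (.inr hxy)
      exact ⟨q', hy, hq.trans hq'⟩
  | refl => rfl
  | symm _ _ _ ih => exact ih.symm
  | trans _ _ _ _ _ ih₁ ih₂ => exact ih₁.trans ih₂

/-- The quotient map `ρ` of `X ⊕ X'` identifies two points of the same summand exactly when the
quotient map `π` or `π'` of the summand does, and it glues the class of `b i` to the class of `b' i`
for every index `i`. -/
structure GluesAlong {I X X' Y Y' Z : Type*} (π : X → Y) (π' : X' → Y') (ρ : X ⊕ X' → Z)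
    (b : I → X) (b' : I → X') : Prop where
  inl_inl : ∀ x y, ρ (.inl x) = ρ (.inl y) ↔ π x = π y
  inr_inr : ∀ x y, ρ (.inr x) = ρ (.inr y) ↔ π' x = π' y
  inl_inr : ∀ x y, ρ (.inl x) = ρ (.inr y) ↔ ∃ i, π x = π (b i) ∧ π' y = π' (b' i)

/-- The classes of `X` and of `X'` that make up the class of a point of `X ⊕ X'` once the class of
`b i` is glued to the class of `b' i` for every `i`. -/
def gluedClasses {I X X' Y Y' : Type*} (π : X → Y) (π' : X' → Y') (b : I → X) (b' : I → X') :
    X ⊕ X' → Set Y × Set Y' :=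
  Sum.elim (fun x => ({π x}, {y | ∃ i, π x = π (b i) ∧ y = π' (b' i)}))
    (fun y => ({x | ∃ i, π' y = π' (b' i) ∧ x = π (b i)}, {π' y}))

section

variable {I X X' Y Y' Z : Type*} {π : X → Y} {π' : X' → Y'} {ρ : X ⊕ X' → Z}
  {b : I → X} {b' : I → X'}

theorem gluedClasses_congr_inl {x y : X} (h : π x = π y) :
    gluedClasses π π' b b' (.inl x) = gluedClasses π π' b b' (.inl y) := by
  simp [gluedClasses, h]

theorem gluedClasses_congr_inr {x y : X'} (h : π' x = π' y) :
    gluedClasses π π' b b' (.inr x) = gluedClasses π π' b b' (.inr y) := by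
  simp [gluedClasses, h]

theorem gluedClasses_glued (hb : ∀ i j, π (b i) = π (b j) ↔ π' (b' i) = π' (b' j)) (i : I) :
    gluedClasses π π' b b' (.inl (b i)) = gluedClasses π π' b b' (.inr (b' i)) := by
  simp only [gluedClasses, Sum.elim_inl, Sum.elim_inr, Prod.mk.injEq]
  constructor
  · ext x
    simp only [Set.mem_singleton_iff, Set.mem_ofPred_eq]
    exact ⟨fun h => ⟨i, rfl, h⟩, fun ⟨j, hj, hx⟩ => hx.trans ((hb i j).2 hj).symm⟩
  · ext y
    simp only [Set.mem_singleton_iff, Set.mem_ofPred_eq]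
    exact ⟨fun ⟨j, hj, hy⟩ => hy.trans ((hb i j).1 hj).symm, fun h => ⟨i, rfl, h⟩⟩

/-- If `ρ` glues at least what it should and does not separate the points of `gluedClasses`, then it
glues no more than that. -/
theorem GluesAlong.mk' (hl : ∀ x y, π x = π y → ρ (.inl x) = ρ (.inl y))
    (hr : ∀ x y, π' x = π' y → ρ (.inr x) = ρ (.inr y))
    (hm : ∀ i, ρ (.inl (b i)) = ρ (.inr (b' i)))
    (hρ : ∀ u v, ρ u = ρ v → gluedClasses π π' b b' u = gluedClasses π π' b b' v) :
    GluesAlong π π' ρ b b' where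
  inl_inl x y := ⟨fun h => by
    simpa [gluedClasses] using congr_arg Prod.fst (hρ _ _ h), hl x y⟩
  inr_inr x y := ⟨fun h => by
    simpa [gluedClasses] using congr_arg Prod.snd (hρ _ _ h), hr x y⟩
  inl_inr x y := by
    constructor
    · intro h
      have h₁ : π x ∈ (gluedClasses π π' b b' (.inr y)).1 := by
        rw [← hρ _ _ h]; exact rfl
      obtain ⟨i, hi, hx⟩ := h₁
      exact ⟨i, hx, hi⟩
    · rintro ⟨i, hx, hy⟩
      rw [hl _ _ hx, hr _ _ hy, hm]

theorem GluesAlong.of_eqvGen {R : X ⊕ X' → X ⊕ X' → Prop}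
    (hl : ∀ x y, π x = π y → EqvGen R (.inl x) (.inl y))
    (hr : ∀ x y, π' x = π' y → EqvGen R (.inr x) (.inr y))
    (hm : ∀ i, EqvGen R (.inl (b i)) (.inr (b' i)))
    (hR : ∀ u v, R u v → gluedClasses π π' b b' u = gluedClasses π π' b b' v) :
    GluesAlong π π' (Quotient.mk (EqvGen.setoid R)) b b' :=
  .mk' (fun x y h => Quotient.sound (hl x y h)) (fun x y h => Quotient.sound (hr x y h))
    (fun i => Quotient.sound (hm i)) fun u v huv => by
      replace huv : EqvGen R u v := Quotient.exact huv
      induction huv with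
      | rel _ _ h => exact hR _ _ h
      | refl => rfl
      | symm _ _ _ ih => exact ih.symm
      | trans _ _ _ _ _ ih₁ ih₂ => exact ih₁.trans ih₂

theorem ncard_image_eq {X Y Z : Type*} {f : X → Y} {g : X → Z} {s : Set X}
    (h : ∀ x y, f x = f y ↔ g x = g y) : (f '' s).ncard = (g '' s).ncard := by
  refine Set.ncard_congr (fun y hy => g hy.choose) (fun y hy => ⟨_, hy.choose_spec.1, rfl⟩) ?_ ?_
  · intro y z hy hz hyz
    rw [← hy.choose_spec.2, ← hz.choose_spec.2]
    exact (h _ _).2 hyz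
  · rintro _ ⟨x, hx, rfl⟩
    have hy : f x ∈ f '' s := ⟨x, hx, rfl⟩
    exact ⟨f x, hy, (h _ _).1 hy.choose_spec.2⟩

/-- Inclusion and exclusion for the classes that meet two saturated sets. -/
theorem GluesAlong.ncard_image [Finite X] [Finite X'] (g : GluesAlong π π' ρ b b')
    {s : Set X} {s' : Set X'} (hs : ∀ x y, π x = π y → x ∈ s → y ∈ s)
    (hb : ∀ i, b i ∈ s ↔ b' i ∈ s') :
    (ρ '' (Sum.inl '' s ∪ Sum.inr '' s')).ncard + ((fun i => π (b i)) '' {i | b i ∈ s}).ncard =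
      (π '' s).ncard + (π' '' s').ncard := by
  have h₁ : (π '' s).ncard = (ρ '' (Sum.inl '' s)).ncard := by
    rw [Set.image_image]; exact ncard_image_eq fun x y => (g.inl_inl x y).symm
  have h₂ : (π' '' s').ncard = (ρ '' (Sum.inr '' s')).ncard := by
    rw [Set.image_image]; exact ncard_image_eq fun x y => (g.inr_inr x y).symm
  have h₃ : (fun i => ρ (.inl (b i))) '' {i | b i ∈ s} =
      ρ '' (Sum.inl '' s) ∩ ρ '' (Sum.inr '' s') := by
    ext z
    constructor
    · rintro ⟨i, hi, rfl⟩
      exact ⟨⟨_, ⟨_, hi, rfl⟩, rfl⟩, ⟨_, ⟨_, (hb i).1 hi, rfl⟩,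
        ((g.inl_inr _ _).2 ⟨i, rfl, rfl⟩).symm⟩⟩
    · rintro ⟨⟨_, ⟨x, hx, rfl⟩, rfl⟩, ⟨_, ⟨y, hy, rfl⟩, hxy⟩⟩
      obtain ⟨i, hi, -⟩ := (g.inl_inr _ _).1 hxy.symm
      exact ⟨i, hs _ _ hi hx, (g.inl_inl _ _).2 hi.symm⟩
  rw [h₁, h₂, Set.image_union, ← Set.ncard_union_add_ncard_inter _ _ (Set.toFinite _)
    (Set.toFinite _), ← h₃, ncard_image_eq fun i j => (g.inl_inl (b i) (b j)).symm]

end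

/-! ### Vertices, components and cuts of polygon gluings -/

theorem eqvGen_flip {X : Type*} {r : X → X → Prop} {x y : X} (h : EqvGen r x y) :
    EqvGen (flip r) x y := by
  induction h with
  | rel x y h => exact .symm _ _ (.rel _ _ h)
  | refl => exact .refl _
  | symm _ _ _ ih => exact .symm _ _ ih
  | trans _ _ _ _ _ ih₁ ih₂ => exact .trans _ _ _ ih₁ ih₂

namespace PolygonGluing

section

variable {D : Type*} {M : PolygonGluing D}

theorem tail_next_opp {d : D} (hd : ¬ M.IsBoundary d) : M.tail (M.next (M.opp d)) = M.tail d :=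
  (Quotient.sound (EqvGen.rel _ _ ⟨hd, rfl⟩)).symm

/-- The darts at a vertex are linearly or cyclically ordered, so at most one of them is a boundary
edge. -/
theorem eq_of_tail_eq {d e : D} (hd : M.IsBoundary d) (he : M.IsBoundary e)
    (h : M.tail d = M.tail e) : d = e :=
  eq_of_eqvGen_of_terminal (fun _ _ _ h₁ h₂ => h₁.2.trans h₂.2.symm) (fun _ h => h.1 hd)
    (fun _ h => h.1 he) (Quotient.exact h)

theorem eq_of_head_eq (hM : Function.Involutive M.opp) {d e : D} (hd : M.IsBoundary d)
    (he : M.IsBoundary e) (h : M.head d = M.head e) : d = e := by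
  have key : ∀ {d : D}, M.IsBoundary d → ∀ y, ¬ flip
      (fun d e => ¬ M.IsBoundary d ∧ e = M.next (M.opp d)) (M.next d) y := by
    rintro d hd y ⟨h₁, h₂⟩
    have h₃ : M.opp d = y := by rw [M.next.injective h₂, hM]
    exact h₁ (by rw [← h₃, hd]; exact hd)
  refine M.next.injective (eq_of_eqvGen_of_terminal ?_ (key hd) (key he)
    (eqvGen_flip (Quotient.exact h)))
  rintro x y z ⟨-, h₁⟩ ⟨-, h₂⟩
  exact hM.injective (M.next.injective (h₁.symm.trans h₂))

theorem component_next (d : D) : M.component (M.next d) = M.component d :=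
  (Quotient.sound (EqvGen.rel _ _ (.inl rfl))).symm

theorem component_opp (d : D) : M.component (M.opp d) = M.component d :=
  (Quotient.sound (EqvGen.rel _ _ (.inr rfl))).symm

theorem component_eq_of_tail_eq {d e : D} (h : M.tail d = M.tail e) :
    M.component d = M.component e := by
  replace h : EqvGen _ d e := Quotient.exact h
  induction h with
  | rel _ _ h => rw [h.2, component_next, component_opp]
  | refl => rfl
  | symm _ _ _ ih => exact ih.symm
  | trans _ _ _ _ _ ih₁ ih₂ => exact ih₁.trans ih₂

theorem component_eq_of_sameCycle {d e : D} (h : M.next.SameCycle d e) :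
    M.component d = M.component e := by
  obtain ⟨n, rfl⟩ := h
  have : ∀ n : ℤ, M.component ((M.next ^ n) d) = M.component d := by
    intro n
    induction n using Int.induction_on with
    | zero => rfl
    | succ n ih => rw [add_comm, zpow_add, zpow_one, Equiv.Perm.mul_apply, component_next, ih]
    | pred n ih =>
      rw [← ih, ← component_next, ← Equiv.Perm.mul_apply, ← zpow_one_add]
      congr 3; ring
  exact (this n).symm

variable {s : Set D}

theorem cut_isBoundary {d : D} : (M.cut s).IsBoundary d ↔ d ∈ s ∨ M.IsBoundary d := by
  unfold IsBoundary cut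
  by_cases hd : d ∈ s <;> simp [hd]

theorem cut_opp_of_notMem {d : D} (hd : d ∉ s) : (M.cut s).opp d = M.opp d := if_neg hd

theorem cut_involutive (hM : Function.Involutive M.opp) (hs : ∀ d ∈ s, M.opp d ∈ s) :
    Function.Involutive (M.cut s).opp := by
  intro d
  by_cases hd : d ∈ s
  · simp [cut, hd]
  · have : M.opp d ∉ s := fun h => hd (hM d ▸ hs _ h)
    rw [cut_opp_of_notMem hd, cut_opp_of_notMem this, hM]

theorem tail_eq_of_cut_tail_eq {d e : D} (h : (M.cut s).tail d = (M.cut s).tail e) :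
    M.tail d = M.tail e := by
  replace h : EqvGen _ d e := Quotient.exact h
  induction h with
  | rel x y h =>
    obtain ⟨h₁, rfl⟩ := h
    rw [cut_isBoundary, not_or] at h₁
    rw [cut_opp_of_notMem h₁.1]
    exact (tail_next_opp h₁.2).symm
  | refl => rfl
  | symm _ _ _ ih => exact ih.symm
  | trans _ _ _ _ _ ih₁ ih₂ => exact ih₁.trans ih₂

/-- Cutting does not change a vertex that lies on none of the edges cut. -/
theorem cut_tail_eq_of_tail_eq {d e : D} (hd : ∀ t ∈ s, M.tail t ≠ M.tail d)
    (h : M.tail d = M.tail e) : (M.cut s).tail d = (M.cut s).tail e := by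
  replace h : EqvGen _ d e := Quotient.exact h
  suffices H : ∀ v, (∀ t ∈ s, M.tail t ≠ v) → M.tail d = v ∧ M.tail e = v →
      (M.cut s).tail d = (M.cut s).tail e from H _ hd ⟨rfl, (Quotient.sound h).symm⟩
  clear hd
  intro v hv
  induction h with
  | rel x y h =>
    rintro ⟨hx, -⟩
    obtain ⟨h₁, rfl⟩ := h
    have hxs : x ∉ s := fun h => hv x h hx
    have := tail_next_opp (M := M.cut s) (d := x) (by simp [cut_isBoundary, hxs, h₁])
    rw [cut_opp_of_notMem hxs] at this
    exact this.symm
  | refl => exact fun _ => rfl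
  | symm _ _ _ ih => exact fun h => (ih h.symm).symm
  | trans x y z h₁ _ ih₁ ih₂ =>
    rintro ⟨hx, hz⟩
    have hy : M.tail y = v := by rw [← hx]; exact (Quotient.sound h₁).symm
    exact (ih₁ ⟨hx, hy⟩).trans (ih₂ ⟨hy, hz⟩)

/-- A boundary vertex survives a cut exactly if no edge that is cut ends there. -/
theorem cut_head_eq_cut_tail_iff (hM : Function.Involutive M.opp) (hs : ∀ d ∈ s, M.opp d ∈ s)
    (hs' : ∀ d ∈ s, ¬ M.IsBoundary d) {b c : D} (hb : M.IsBoundary b) (hc : M.IsBoundary c)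
    (h : M.head b = M.tail c) :
    (M.cut s).head b = (M.cut s).tail c ↔ ¬ ∃ t ∈ s, M.tail t = M.tail c := by
  constructor
  · rintro hbc ⟨t, ht, htc⟩
    have hb' : (M.cut s).IsBoundary b := cut_isBoundary.2 (.inr hb)
    have hc' : (M.cut s).IsBoundary c := cut_isBoundary.2 (.inr hc)
    -- The class of `c` in the cut surface is closed under rotation in the original one.
    have key : ∀ v, (M.cut s).tail c = v → ((M.cut s).tail t = v ↔ (M.cut s).tail c = v) := by
      intro v hcv
      have hv : ∀ x ∈ s, (M.cut s).tail x ≠ v := fun x hx hxv => by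
        have := eq_of_tail_eq (cut_isBoundary.2 (.inl hx)) hc' (hxv.trans hcv.symm)
        exact hs' x hx (this ▸ hc)
      rw [hcv] at hbc
      replace htc : EqvGen _ t c := Quotient.exact htc
      clear h ht hc hc' hcv
      induction htc with
      | rel x y h =>
        obtain ⟨h₁, rfl⟩ := h
        by_cases hx : x ∈ s
        · refine iff_of_false (hv x hx) fun hn => ?_
          have := eq_of_head_eq (cut_involutive hM hs) (cut_isBoundary.2 (.inl (hs x hx))) hb'
            (Eq.trans hn hbc.symm)
          exact hs' _ (hs x hx) (this ▸ hb)
        · have := tail_next_opp (M := M.cut s) (d := x) (by simp [cut_isBoundary, hx, h₁])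
          rw [cut_opp_of_notMem hx] at this
          exact this ▸ Iff.rfl
      | refl => rfl
      | symm _ _ _ ih => exact ih.symm
      | trans _ _ _ _ _ ih₁ ih₂ => exact ih₁.trans ih₂
    have := eq_of_tail_eq (cut_isBoundary.2 (.inl ht)) hc' ((key _ rfl).2 rfl)
    exact hs' t ht (this ▸ hc)
  · intro ht
    exact cut_tail_eq_of_tail_eq (fun t hts h' => ht ⟨t, hts, h'.trans h⟩) h

end

/-! ### Gluing two surfaces along boundary edges -/

variable {D D' P : Type*}

open Classical in
/-- The surface obtained from `M` and `M'` by pasting the edge `a p` to the edge `a' p`, for every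
index `p`. -/
noncomputable def glue (M : PolygonGluing D) (M' : PolygonGluing D') (a : P → D) (a' : P → D') :
    PolygonGluing (D ⊕ D') where
  next := Equiv.sumCongr M.next M'.next
  opp := Sum.elim
    (fun d => if h : ∃ p, a p = d then Sum.inr (a' h.choose) else Sum.inl (M.opp d))
    (fun d => if h : ∃ p, a' p = d then Sum.inl (a h.choose) else Sum.inr (M'.opp d))

/-- The conditions under which the edges `a p` of `M` can be pasted to the edges `a' p` of `M'`: they
are different boundary edges, and they are adjacent in the same way. -/
structure Gluable (M : PolygonGluing D) (M' : PolygonGluing D') (a : P → D) (a' : P → D') :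
    Prop where
  left_involutive : Function.Involutive M.opp
  right_involutive : Function.Involutive M'.opp
  left_boundary : ∀ p, M.IsBoundary (a p)
  right_boundary : ∀ p, M'.IsBoundary (a' p)
  left_injective : Function.Injective a
  right_injective : Function.Injective a'
  adjacent : ∀ p q, M.head (a p) = M.tail (a q) ↔ M'.head (a' q) = M'.tail (a' p)

namespace Gluable

variable {M : PolygonGluing D} {M' : PolygonGluing D'} {a : P → D} {a' : P → D'}

theorem opp_left (h : Gluable M M' a a') (p : P) :
    (glue M M' a a').opp (.inl (a p)) = .inr (a' p) := by
  have hp : ∃ q, a q = a p := ⟨p, rfl⟩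
  simp only [glue, Sum.elim_inl, dif_pos hp]
  rw [h.left_injective hp.choose_spec]

theorem opp_right (h : Gluable M M' a a') (p : P) :
    (glue M M' a a').opp (.inr (a' p)) = .inl (a p) := by
  have hp : ∃ q, a' q = a' p := ⟨p, rfl⟩
  simp only [glue, Sum.elim_inr, dif_pos hp]
  rw [h.right_injective hp.choose_spec]

end Gluable

variable {M : PolygonGluing D} {M' : PolygonGluing D'} {a : P → D} {a' : P → D'}

theorem glue_opp_inl {d : D} (hd : d ∉ Set.range a) :
    (glue M M' a a').opp (.inl d) = .inl (M.opp d) := dif_neg hd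

theorem glue_opp_inr {d : D'} (hd : d ∉ Set.range a') :
    (glue M M' a a').opp (.inr d) = .inr (M'.opp d) := dif_neg hd

@[simp] theorem glue_next_inl (d : D) : (glue M M' a a').next (.inl d) = .inl (M.next d) := rfl

@[simp] theorem glue_next_inr (d : D') : (glue M M' a a').next (.inr d) = .inr (M'.next d) := rfl

namespace Gluable

theorem isBoundary_inl (h : Gluable M M' a a') {d : D} :
    (glue M M' a a').IsBoundary (.inl d) ↔ M.IsBoundary d ∧ d ∉ Set.range a := by
  by_cases hd : d ∈ Set.range a
  · obtain ⟨p, rfl⟩ := hd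
    simp [IsBoundary, h.opp_left]
  · simp [IsBoundary, glue_opp_inl hd, hd]

theorem isBoundary_inr (h : Gluable M M' a a') {d : D'} :
    (glue M M' a a').IsBoundary (.inr d) ↔ M'.IsBoundary d ∧ d ∉ Set.range a' := by
  by_cases hd : d ∈ Set.range a'
  · obtain ⟨p, rfl⟩ := hd
    simp [IsBoundary, h.opp_right]
  · simp [IsBoundary, glue_opp_inr hd, hd]

theorem involutive (h : Gluable M M' a a') : Function.Involutive (glue M M' a a').opp := by
  rintro (d | d)
  · by_cases hd : d ∈ Set.range a
    · obtain ⟨p, rfl⟩ := hd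
      rw [h.opp_left, h.opp_right]
    · have : M.opp d ∉ Set.range a := by
        rintro ⟨p, hp⟩
        refine hd ⟨p, ?_⟩
        rw [← h.left_involutive d, ← hp, h.left_boundary p]
      rw [glue_opp_inl hd, glue_opp_inl this, h.left_involutive]
  · by_cases hd : d ∈ Set.range a'
    · obtain ⟨p, rfl⟩ := hd
      rw [h.opp_right, h.opp_left]
    · have : M'.opp d ∉ Set.range a' := by
        rintro ⟨p, hp⟩
        refine hd ⟨p, ?_⟩
        rw [← h.right_involutive d, ← hp, h.right_boundary p]
      rw [glue_opp_inr hd, glue_opp_inr this, h.right_involutive]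

/-- The starting point of `a p` is glued to the end of `a' p`, and vice versa. -/
theorem tail (h : Gluable M M' a a') :
    GluesAlong M.tail M'.tail (glue M M' a a').tail
      (Sum.elim a (M.next ∘ a)) (Sum.elim (M'.next ∘ a') a') := by
  have hb : ∀ i j, M.tail (Sum.elim a (M.next ∘ a) i) = M.tail (Sum.elim a (M.next ∘ a) j) ↔
      M'.tail (Sum.elim (M'.next ∘ a') a' i) = M'.tail (Sum.elim (M'.next ∘ a') a' j) := by
    have h₁ : ∀ p q, M.tail (a p) = M.tail (a q) ↔ p = q := fun p q =>
      ⟨fun e => h.left_injective (eq_of_tail_eq (h.left_boundary p) (h.left_boundary q) e),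
        fun e => e ▸ rfl⟩
    have h₂ : ∀ p q, M.tail (M.next (a p)) = M.tail (M.next (a q)) ↔ p = q := fun p q =>
      ⟨fun e => h.left_injective (eq_of_head_eq h.left_involutive (h.left_boundary p)
        (h.left_boundary q) e), fun e => e ▸ rfl⟩
    have h₃ : ∀ p q, M'.tail (a' p) = M'.tail (a' q) ↔ p = q := fun p q =>
      ⟨fun e => h.right_injective (eq_of_tail_eq (h.right_boundary p) (h.right_boundary q) e),
        fun e => e ▸ rfl⟩
    have h₄ : ∀ p q, M'.tail (M'.next (a' p)) = M'.tail (M'.next (a' q)) ↔ p = q := fun p q =>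
      ⟨fun e => h.right_injective (eq_of_head_eq h.right_involutive (h.right_boundary p)
        (h.right_boundary q) e), fun e => e ▸ rfl⟩
    have h₅ : ∀ p q, M.tail (M.next (a p)) = M.tail (a q) ↔
      M'.tail (M'.next (a' q)) = M'.tail (a' p) := h.adjacent
    rintro (p | p) (q | q)
    · simp [h₁, h₄]
    · simpa [eq_comm] using h₅ q p
    · simpa [eq_comm] using h₅ p q
    · simp [h₂, h₃]
  have left : ∀ x, ¬ M.IsBoundary x → ¬ (glue M M' a a').IsBoundary (.inl x) ∧
      (.inl (M.next (M.opp x)) : D ⊕ D') =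
        (glue M M' a a').next ((glue M M' a a').opp (.inl x)) := fun x hx => by
    refine ⟨fun hx' => hx (h.isBoundary_inl.1 hx').1, ?_⟩
    rw [glue_opp_inl (by rintro ⟨p, rfl⟩; exact hx (h.left_boundary p)), glue_next_inl]
  have right : ∀ x, ¬ M'.IsBoundary x → ¬ (glue M M' a a').IsBoundary (.inr x) ∧
      (.inr (M'.next (M'.opp x)) : D ⊕ D') =
        (glue M M' a a').next ((glue M M' a a').opp (.inr x)) := fun x hx => by
    refine ⟨fun hx' => hx (h.isBoundary_inr.1 hx').1, ?_⟩
    rw [glue_opp_inr (by rintro ⟨p, rfl⟩; exact hx (h.right_boundary p)), glue_next_inr]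
  refine GluesAlong.of_eqvGen (fun x y hxy => ?_) (fun x y hxy => ?_) ?_ ?_
  · replace hxy : EqvGen _ x y := Quotient.exact hxy
    induction hxy with
    | rel x y hxy => obtain ⟨hx, rfl⟩ := hxy; exact .rel _ _ (left x hx)
    | refl => exact .refl _
    | symm _ _ _ ih => exact .symm _ _ ih
    | trans _ _ _ _ _ ih₁ ih₂ => exact .trans _ _ _ ih₁ ih₂
  · replace hxy : EqvGen _ x y := Quotient.exact hxy
    induction hxy with
    | rel x y hxy => obtain ⟨hx, rfl⟩ := hxy; exact .rel _ _ (right x hx)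
    | refl => exact .refl _
    | symm _ _ _ ih => exact .symm _ _ ih
    | trans _ _ _ _ _ ih₁ ih₂ => exact .trans _ _ _ ih₁ ih₂
  · rintro (p | p)
    · refine .rel _ _ ⟨fun hp => (h.isBoundary_inl.1 hp).2 ⟨p, rfl⟩, ?_⟩
      exact congr_arg (glue M M' a a').next (h.opp_left p).symm
    · refine .symm _ _ (.rel _ _ ⟨fun hp => (h.isBoundary_inr.1 hp).2 ⟨p, rfl⟩, ?_⟩)
      exact congr_arg (glue M M' a a').next (h.opp_right p).symm
  · rintro u v ⟨hu, rfl⟩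
    rcases u with x | x
    · by_cases hx : x ∈ Set.range a
      · obtain ⟨p, rfl⟩ := hx
        rw [h.opp_left, glue_next_inr]
        exact gluedClasses_glued hb (.inl p)
      · rw [glue_opp_inl hx, glue_next_inl]
        refine gluedClasses_congr_inl (tail_next_opp fun hb => hu ?_).symm
        exact h.isBoundary_inl.2 ⟨hb, hx⟩
    · by_cases hx : x ∈ Set.range a'
      · obtain ⟨p, rfl⟩ := hx
        rw [h.opp_right, glue_next_inl]
        exact (gluedClasses_glued hb (.inr p)).symm
      · rw [glue_opp_inr hx, glue_next_inr]
        refine gluedClasses_congr_inr (tail_next_opp fun hb => hu ?_).symm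
        exact h.isBoundary_inr.2 ⟨hb, hx⟩

theorem component (h : Gluable M M' a a')
    (hc : ∀ p q, M.component (a p) = M.component (a q) ↔
      M'.component (a' p) = M'.component (a' q)) :
    GluesAlong M.component M'.component (glue M M' a a').component a a' := by
  have hn : ∀ u, EqvGen (fun d e => e = (glue M M' a a').next d ∨ e = (glue M M' a a').opp d) u
    ((glue M M' a a').next u) := fun u => .rel _ _ (.inl rfl)
  have ho : ∀ u, EqvGen (fun d e => e = (glue M M' a a').next d ∨ e = (glue M M' a a').opp d) u
    ((glue M M' a a').opp u) := fun u => .rel _ _ (.inr rfl)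
  refine GluesAlong.of_eqvGen (fun x y hxy => ?_) (fun x y hxy => ?_) ?_ ?_
  · replace hxy : EqvGen _ x y := Quotient.exact hxy
    induction hxy with
    | rel x y hxy =>
      obtain rfl | rfl := hxy
      · exact hn _
      · by_cases hx : x ∈ Set.range a
        · obtain ⟨p, rfl⟩ := hx
          rw [h.left_boundary p]
          exact .refl _
        · exact glue_opp_inl (M' := M') (a' := a') hx ▸ ho (.inl x)
    | refl => exact .refl _
    | symm _ _ _ ih => exact .symm _ _ ih
    | trans _ _ _ _ _ ih₁ ih₂ => exact .trans _ _ _ ih₁ ih₂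
  · replace hxy : EqvGen _ x y := Quotient.exact hxy
    induction hxy with
    | rel x y hxy =>
      obtain rfl | rfl := hxy
      · exact hn _
      · by_cases hx : x ∈ Set.range a'
        · obtain ⟨p, rfl⟩ := hx
          rw [h.right_boundary p]
          exact .refl _
        · exact glue_opp_inr (M := M) (a := a) hx ▸ ho (.inr x)
    | refl => exact .refl _
    | symm _ _ _ ih => exact .symm _ _ ih
    | trans _ _ _ _ _ ih₁ ih₂ => exact .trans _ _ _ ih₁ ih₂
  · exact fun p => h.opp_left p ▸ ho (.inl (a p))
  · rintro (x | x) v (rfl | rfl)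
    · exact gluedClasses_congr_inl (component_next x).symm
    · by_cases hx : x ∈ Set.range a
      · obtain ⟨p, rfl⟩ := hx
        rw [h.opp_left]
        exact gluedClasses_glued hc p
      · rw [glue_opp_inl hx]
        exact gluedClasses_congr_inl (component_opp x).symm
    · exact gluedClasses_congr_inr (component_next x).symm
    · by_cases hx : x ∈ Set.range a'
      · obtain ⟨p, rfl⟩ := hx
        rw [h.opp_right]
        exact (gluedClasses_glued hc p).symm
      · rw [glue_opp_inr hx]
        exact gluedClasses_congr_inr (component_opp x).symm

end Gluable

theorem edge_eq_iff {D : Type*} {M : PolygonGluing D} (hM : Function.Involutive M.opp) {d e : D} :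
    s(d, M.opp d) = s(e, M.opp e) ↔ d = e ∨ d = M.opp e := by
  rw [Sym2.eq_iff]
  constructor
  · rintro (⟨h, -⟩ | ⟨h, -⟩) <;> simp [h]
  · rintro (rfl | rfl)
    · simp
    · simp [hM e]

theorem Gluable.edge (h : Gluable M M' a a') :
    GluesAlong (fun d => s(d, M.opp d)) (fun d => s(d, M'.opp d))
      (fun d => s(d, (glue M M' a a').opp d)) a a' where
  inl_inl x y := by
    rw [edge_eq_iff h.involutive, edge_eq_iff h.left_involutive]
    by_cases hy : y ∈ Set.range a
    · obtain ⟨p, rfl⟩ := hy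
      rw [h.opp_left, h.left_boundary p]
      simp
    · simp [glue_opp_inl hy]
  inr_inr x y := by
    rw [edge_eq_iff h.involutive, edge_eq_iff h.right_involutive]
    by_cases hy : y ∈ Set.range a'
    · obtain ⟨p, rfl⟩ := hy
      rw [h.opp_right, h.right_boundary p]
      simp
    · simp [glue_opp_inr hy]
  inl_inr x y := by
    rw [edge_eq_iff h.involutive]
    have h₁ : ∀ p, s(x, M.opp x) = s(a p, M.opp (a p)) ↔ x = a p := fun p => by
      rw [edge_eq_iff h.left_involutive, h.left_boundary p, or_self]
    have h₂ : ∀ p, s(y, M'.opp y) = s(a' p, M'.opp (a' p)) ↔ y = a' p := fun p => by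
      rw [edge_eq_iff h.right_involutive, h.right_boundary p, or_self]
    simp only [h₁, h₂, reduceCtorEq, false_or]
    by_cases hy : y ∈ Set.range a'
    · obtain ⟨p, rfl⟩ := hy
      simp [h.opp_right, h.right_injective.eq_iff]
    · rw [glue_opp_inr hy]
      refine iff_of_false (by simp) ?_
      rintro ⟨p, -, rfl⟩
      exact hy ⟨p, rfl⟩

theorem glue_polygon : GluesAlong (Quotient.mk (Equiv.Perm.SameCycle.setoid M.next))
    (Quotient.mk (Equiv.Perm.SameCycle.setoid M'.next))
    (Quotient.mk (Equiv.Perm.SameCycle.setoid (glue M M' a a').next))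
    (Empty.elim : Empty → D) (Empty.elim : Empty → D') := by
  have hz : ∀ n : ℤ, (glue M M' a a').next ^ n = Equiv.sumCongr (M.next ^ n) (M'.next ^ n) :=
    fun n => (map_zpow (Equiv.Perm.sumCongrHom D D') (M.next, M'.next) n).symm
  have hc : ∀ u v, (glue M M' a a').next.SameCycle u v ↔
      ∃ n : ℤ, Equiv.sumCongr (M.next ^ n) (M'.next ^ n) u = v :=
    fun u v => exists_congr fun n => by rw [hz]
  refine ⟨fun x y => ?_, fun x y => ?_, fun x y => ?_⟩ <;> rw [Quotient.eq] <;>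
    refine (hc _ _).trans ?_
  · rw [Quotient.eq]; simp; rfl
  · rw [Quotient.eq]; simp; rfl
  · simp

end PolygonGluing

namespace PolygonGluing

/-! ### The Euler characteristic of a glued surface -/

/-- Vertices minus edges plus polygons, counting only the starting points, edges and polygons of the
darts of `s`. -/
noncomputable def eulerOn {D : Type*} (M : PolygonGluing D) (s : Set D) : ℤ :=
  ((M.tail '' s).ncard : ℤ) - (((fun d => s(d, M.opp d)) '' s).ncard : ℤ)
    + ((Quotient.mk (Equiv.Perm.SameCycle.setoid M.next) '' s).ncard : ℤ)

theorem eulerOn_empty {D : Type*} (M : PolygonGluing D) : M.eulerOn ∅ = 0 := by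
  simp [eulerOn]

variable {D D' P : Type*} {M : PolygonGluing D} {M' : PolygonGluing D'}
  {a : P → D} {a' : P → D'}

/-- The number of vertices on the pasted edges is the number of these edges, which counts their
starting points, plus the number of end points that are not starting points. -/
theorem Gluable.ncard_glued_vertices [Finite D] (h : Gluable M M' a a') {s : Set D}
    (hs : ∀ x y, M.component x = M.component y → x ∈ s → y ∈ s) :
    ((fun i => M.tail (Sum.elim a (M.next ∘ a) i)) '' {i | Sum.elim a (M.next ∘ a) i ∈ s}).ncard =
      {p | a p ∈ s}.ncard + {p | a p ∈ s ∧ ∀ q, M.head (a p) ≠ M.tail (a q)}.ncard := by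
  have : Finite P := Finite.of_injective a h.left_injective
  have h₁ : (fun i => M.tail (Sum.elim a (M.next ∘ a) i)) '' {i | Sum.elim a (M.next ∘ a) i ∈ s} =
      (fun p => M.tail (a p)) '' {p | a p ∈ s} ∪
        (fun p => M.head (a p)) '' {p | a p ∈ s ∧ ∀ q, M.head (a p) ≠ M.tail (a q)} := by
    ext v
    constructor
    · rintro ⟨p | p, hp, rfl⟩
      · exact .inl ⟨p, hp, rfl⟩
      · have hp' : a p ∈ s := hs _ _ (component_next _) hp
        by_cases hq : ∃ q, M.head (a p) = M.tail (a q)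
        · obtain ⟨q, hq⟩ := hq
          exact .inl ⟨q, hs _ _ (component_eq_of_tail_eq hq) hp, hq.symm⟩
        · exact .inr ⟨p, ⟨hp', not_exists.1 hq⟩, rfl⟩
    · rintro (⟨p, hp, rfl⟩ | ⟨p, ⟨hp, -⟩, rfl⟩)
      · exact ⟨.inl p, hp, rfl⟩
      · exact ⟨.inr p, hs _ _ (component_next _).symm hp, rfl⟩
  rw [h₁, Set.ncard_union_eq, Set.ncard_image_of_injective, Set.ncard_image_of_injective]
  · exact fun p q hpq => h.left_injective
      (eq_of_head_eq h.left_involutive (h.left_boundary p) (h.left_boundary q) hpq)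
  · exact fun p q hpq => h.left_injective
      (eq_of_tail_eq (h.left_boundary p) (h.left_boundary q) hpq)
  · rw [Set.disjoint_left]
    rintro _ ⟨q, -, rfl⟩ ⟨p, ⟨-, hp⟩, hpq⟩
    exact hp q hpq

variable [Finite D] [Finite D']

theorem Gluable.eulerOn_glue (h : Gluable M M' a a') {s : Set D} {s' : Set D'}
    (hs : ∀ x y, M.component x = M.component y → x ∈ s → y ∈ s)
    (hs' : ∀ x y, M'.component x = M'.component y → x ∈ s' → y ∈ s')
    (hb : ∀ p, a p ∈ s ↔ a' p ∈ s') :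
    (glue M M' a a').eulerOn (Sum.inl '' s ∪ Sum.inr '' s') = M.eulerOn s + M'.eulerOn s' -
      ({p | a p ∈ s ∧ ∀ q, M.head (a p) ≠ M.tail (a q)}.ncard : ℤ) := by
  have hV := h.tail.ncard_image (s := s) (s' := s')
    (fun x y hxy => hs x y (component_eq_of_tail_eq hxy)) (by
      have h₁ : ∀ x, M.next x ∈ s ↔ x ∈ s := fun x =>
        ⟨hs _ _ (component_next x), hs _ _ (component_next x).symm⟩
      have h₂ : ∀ x, M'.next x ∈ s' ↔ x ∈ s' := fun x =>
        ⟨hs' _ _ (component_next x), hs' _ _ (component_next x).symm⟩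
      rintro (p | p)
      · simpa [h₂] using hb p
      · simpa [h₁] using hb p)
  have hE := h.edge.ncard_image (s := s) (s' := s') (fun x y hxy => hs x y (by
    obtain rfl | rfl := (edge_eq_iff h.left_involutive).1 hxy
    · rfl
    · exact component_opp y)) hb
  have hF := (glue_polygon (M := M) (M' := M') (a := a) (a' := a')).ncard_image (s := s) (s' := s')
    (fun x y hxy => hs x y (component_eq_of_sameCycle (Quotient.exact hxy))) (by rintro ⟨⟩)
  rw [h.ncard_glued_vertices hs] at hV
  have hE' : ((fun p => s(a p, M.opp (a p))) '' {p | a p ∈ s}).ncard = {p | a p ∈ s}.ncard :=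
    Set.ncard_image_of_injective _ fun p q hpq => h.left_injective <| by
      simpa [edge_eq_iff h.left_involutive, show M.opp (a q) = a q from h.left_boundary q]
        using (edge_eq_iff h.left_involutive).1 hpq
  rw [hE'] at hE
  rw [Set.eq_empty_of_isEmpty {i : Empty | Empty.elim i ∈ s}, Set.image_empty, Set.ncard_empty,
    add_zero] at hF
  unfold eulerOn
  zify at hV hE hF
  linarith

theorem Gluable.eulerChar_left (h : Gluable M M' a a')
    (hc : GluesAlong M.component M'.component (glue M M' a a').component a a') {d : D}
    (hd : ∀ p, M.component d ≠ M.component (a p)) :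
    (glue M M' a a').eulerChar ((glue M M' a a').component (.inl d)) =
      M.eulerChar (M.component d) := by
  have hF : {x | (glue M M' a a').component x = (glue M M' a a').component (.inl d)} =
      Sum.inl '' {x | M.component x = M.component d} ∪ Sum.inr '' ∅ := by
    ext (x | x)
    · simp [hc.inl_inl]
    · rw [Set.mem_ofPred_eq, eq_comm, hc.inl_inr]
      simp [hd]
  have := h.eulerOn_glue (s := {x | M.component x = M.component d}) (s' := ∅)
    (fun x y hxy hx => hxy.symm.trans hx) (by simp) (fun p => by simp [(hd p).symm])
  rw [← hF, eulerOn_empty] at this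
  refine this.trans ?_
  simp [(hd _).symm]
  rfl

theorem Gluable.eulerChar_right (h : Gluable M M' a a')
    (hc : GluesAlong M.component M'.component (glue M M' a a').component a a') {d : D'}
    (hd : ∀ p, M'.component d ≠ M'.component (a' p)) :
    (glue M M' a a').eulerChar ((glue M M' a a').component (.inr d)) =
      M'.eulerChar (M'.component d) := by
  have hF : {x | (glue M M' a a').component x = (glue M M' a a').component (.inr d)} =
      Sum.inl '' ∅ ∪ Sum.inr '' {x | M'.component x = M'.component d} := by
    ext (x | x)
    · rw [Set.mem_ofPred_eq, hc.inl_inr]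
      simp [hd]
    · simp [hc.inr_inr]
  have := h.eulerOn_glue (s := ∅) (s' := {x | M'.component x = M'.component d})
    (by simp) (fun x y hxy hx => hxy.symm.trans hx) (fun p => by simp [(hd p).symm])
  rw [← hF, eulerOn_empty] at this
  refine this.trans ?_
  simp
  rfl

/-- The correction term counts the pasted edges of the component that are the last ones of a
pasted arc. -/
theorem Gluable.eulerChar_glued (h : Gluable M M' a a')
    (hc : GluesAlong M.component M'.component (glue M M' a a').component a a')
    (hc' : ∀ p q, M.component (a p) = M.component (a q) ↔ M'.component (a' p) = M'.component (a' q))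
    (p : P) :
    (glue M M' a a').eulerChar ((glue M M' a a').component (.inl (a p))) =
      M.eulerChar (M.component (a p)) + M'.eulerChar (M'.component (a' p)) -
        ({q | M.component (a q) = M.component (a p) ∧
          ∀ r, M.head (a q) ≠ M.tail (a r)}.ncard : ℤ) := by
  have hF : {x | (glue M M' a a').component x = (glue M M' a a').component (.inl (a p))} =
      Sum.inl '' {x | M.component x = M.component (a p)} ∪
      Sum.inr '' {x | M'.component x = M'.component (a' p)} := by
    ext (x | x)
    · simp [hc.inl_inl]
    · rw [Set.mem_ofPred_eq, eq_comm, hc.inl_inr]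
      simp only [Set.mem_union, Set.mem_image, reduceCtorEq, and_false, exists_false, false_or,
        Sum.inr.injEq, exists_eq_right, Set.mem_ofPred_eq]
      exact ⟨fun ⟨i, hi, hx⟩ => hx.trans ((hc' _ _).1 hi).symm, fun hx => ⟨p, rfl, hx⟩⟩
  have := h.eulerOn_glue (s := {x | M.component x = M.component (a p)})
    (s' := {x | M'.component x = M'.component (a' p)})
    (fun x y hxy hx => hxy.symm.trans hx) (fun x y hxy hx => hxy.symm.trans hx) (fun q => hc' q p)
  rw [← hF] at this
  exact this

end PolygonGluing

/-! ### Arcs of marked holes -/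

namespace BoundaryType

variable {B : BoundaryType}

/-- The edge before an edge of a marked hole. -/
def pred (B : BoundaryType) (p : B.Pos) : B.Pos := ⟨p.1, p.2 - 1⟩

@[simp] theorem succ_pred (p : B.Pos) : B.succ (B.pred p) = p :=
  Sigma.ext rfl (heq_of_eq (sub_add_cancel p.2 1))

/-- The equivalence relation on the edges of the marked holes whose classes are the arcs into which
the endpoints divide the holes. -/
def arcSetoid (B : BoundaryType) : Setoid B.Pos :=
  EqvGen.setoid fun p q => q = B.succ p ∧ ¬ B.endpoint q.1 q.2

/-- The arc of an edge. -/
def arc (B : BoundaryType) (p : B.Pos) : Quotient B.arcSetoid := Quotient.mk _ p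

theorem arc_succ {p : B.Pos} (h : ¬ B.endpoint (B.succ p).1 (B.succ p).2) :
    B.arc (B.succ p) = B.arc p :=
  (Quotient.sound (EqvGen.rel _ _ ⟨rfl, h⟩)).symm

theorem arc_hole {p q : B.Pos} (h : B.arc p = B.arc q) : p.1 = q.1 := by
  replace h : EqvGen _ p q := Quotient.exact h
  induction h with
  | rel _ _ h => rw [h.1]; rfl
  | refl => rfl
  | symm _ _ _ ih => exact ih.symm
  | trans _ _ _ _ _ ih₁ ih₂ => exact ih₁.trans ih₂

theorem succ_induction {Q : B.Pos → Prop} {p q : B.Pos} (hpq : p.1 = q.1) (hp : Q p)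
    (h : ∀ r, Q r → Q (B.succ r)) : Q q := by
  obtain ⟨i, k⟩ := p
  obtain ⟨j, l⟩ := q
  obtain rfl : i = j := hpq
  have key : ∀ n : Fin (B.len i + 1), Q ⟨i, k + n⟩ := by
    intro n
    induction n using Fin.induction with
    | zero => simpa using hp
    | succ n ih =>
      rw [← Fin.coeSucc_eq_succ, ← add_assoc]
      exact h _ ih
  have := key (l - k)
  rwa [add_sub_cancel] at this

/-- An arc has exactly one last edge, unless it is a whole hole. -/
theorem ncard_last (p : B.Pos) [Decidable (∃ j, B.endpoint p.1 j)] :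
    {q | B.arc q = B.arc p ∧ B.endpoint (B.succ q).1 (B.succ q).2}.ncard =
      if ∃ j, B.endpoint p.1 j then 1 else 0 := by
  split_ifs with hp
  · have hex : ∃ q, B.arc q = B.arc p ∧ B.endpoint (B.succ q).1 (B.succ q).2 := by
      by_contra! hn
      obtain ⟨j, hj⟩ := hp
      have : B.arc (B.pred ⟨p.1, j⟩) = B.arc p :=
        succ_induction (Q := fun q => B.arc q = B.arc p) (p := p) rfl rfl
          fun r hr => (arc_succ (hn r hr)).trans hr
      refine hn _ this ?_
      rw [succ_pred]
      exact hj
    obtain ⟨q, hq, hq'⟩ := hex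
    rw [Set.ncard_eq_one]
    refine ⟨q, Set.eq_singleton_iff_unique_mem.2 ⟨⟨hq, hq'⟩, ?_⟩⟩
    rintro r ⟨hr, hr'⟩
    refine eq_of_eqvGen_of_terminal (fun _ _ _ h₁ h₂ => h₁.1.trans h₂.1.symm) ?_ ?_
      (Quotient.exact (hr.trans hq.symm))
    · rintro _ ⟨rfl, h⟩
      exact h hr'
    · rintro _ ⟨rfl, h⟩
      exact h hq'
  · rw [Set.ncard_eq_zero]
    refine Set.eq_empty_of_forall_notMem ?_
    rintro q ⟨hq, hq'⟩
    refine hp ?_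
    rw [← arc_hole hq]
    exact ⟨_, hq'⟩

end BoundaryType

/-! ### The faces at the marked holes of a tangle -/

namespace DecoratedTangle

open PolygonGluing

variable {U L : BoundaryType} {D : Type*} {T : DecoratedTangle U L D}

theorem face_eq_of_sameArc {d e : D} (h : T.SameArc d e) : T.face d = T.face e := by
  induction h with
  | rel d e h =>
    exact ((component_eq_of_tail_eq h.2.2).trans (component_next d)).symm
  | refl => rfl
  | symm _ _ _ ih => exact ih.symm
  | trans _ _ _ _ _ ih₁ ih₂ => exact ih₁.trans ih₂

theorem isBoundary_of_sameHole {d e : D} (h : T.surface.SameHole d e) :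
    T.surface.IsBoundary d ↔ T.surface.IsBoundary e := by
  induction h with
  | rel d e h => exact iff_of_true h.1 h.2.1
  | refl => rfl
  | symm _ _ _ ih => exact ih.symm
  | trans _ _ _ _ _ ih₁ ih₂ => exact ih₁.trans ih₂

theorem IsTangle.cutOpen_involutive (hT : T.IsTangle) : Function.Involutive T.cutOpen.opp :=
  cut_involutive hT.opp_opp hT.strand_opp

theorem IsTangle.lower_injective (hT : T.IsTangle) : Function.Injective T.lower :=
  hT.injective.comp Sum.inr_injective

theorem IsTangle.upper_injective (hT : T.IsTangle) : Function.Injective T.upper :=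
  hT.injective.comp Sum.inl_injective

theorem IsTangle.upper_ne_lower (hT : T.IsTangle) (p : U.Pos) (q : L.Pos) :
    T.upper p ≠ T.lower q := fun h => by
  simpa using hT.injective (a₁ := .inl p) (a₂ := .inr q) h

theorem cutOpen_isBoundary {d : D} (hd : T.surface.IsBoundary d) : T.cutOpen.IsBoundary d :=
  cut_isBoundary.2 (.inr hd)

theorem IsTangle.eq_lower_succ (hT : T.IsTangle) {p : L.Pos} {d : D} (hd : T.surface.IsBoundary d)
    (h : T.surface.head (T.lower p) = T.surface.tail d) : d = T.lower (L.succ p) :=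
  eq_of_tail_eq hd (hT.lower_boundary _) (h.symm.trans (hT.lower_succ p))

theorem IsTangle.eq_lower_pred (hT : T.IsTangle) {p : L.Pos} {d : D} (hd : T.surface.IsBoundary d)
    (h : T.surface.head d = T.surface.tail (T.lower p)) : d = T.lower (L.pred p) := by
  refine eq_of_head_eq hT.opp_opp hd (hT.lower_boundary _) (h.trans ?_)
  rw [hT.lower_succ, BoundaryType.succ_pred]

theorem IsTangle.eq_upper_pred (hT : T.IsTangle) {p : U.Pos} {d : D} (hd : T.surface.IsBoundary d)
    (h : T.surface.head (T.upper p) = T.surface.tail d) : d = T.upper (U.pred p) := by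
  refine eq_of_tail_eq hd (hT.upper_boundary _) (h.symm.trans ?_)
  rw [← hT.upper_succ, BoundaryType.succ_pred]

theorem IsTangle.eq_upper_succ (hT : T.IsTangle) {p : U.Pos} {d : D} (hd : T.surface.IsBoundary d)
    (h : T.surface.head d = T.surface.tail (T.upper p)) : d = T.upper (U.succ p) :=
  eq_of_head_eq hT.opp_opp hd (hT.upper_boundary _) (h.trans (hT.upper_succ p).symm)

theorem IsTangle.lower_adjacent (hT : T.IsTangle) (p q : L.Pos) :
    T.surface.head (T.lower p) = T.surface.tail (T.lower q) ↔ q = L.succ p := by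
  refine ⟨fun h => hT.lower_injective (hT.eq_lower_succ (hT.lower_boundary q) h), ?_⟩
  rintro rfl
  exact hT.lower_succ p

theorem IsTangle.upper_adjacent (hT : T.IsTangle) (p q : U.Pos) :
    T.surface.head (T.upper p) = T.surface.tail (T.upper q) ↔ p = U.succ q := by
  refine ⟨fun h => hT.upper_injective (hT.eq_upper_succ (hT.upper_boundary p) h), ?_⟩
  rintro rfl
  exact hT.upper_succ q

theorem IsTangle.lower_adjacent_cutOpen (hT : T.IsTangle) (p q : L.Pos) :
    T.cutOpen.head (T.lower p) = T.cutOpen.tail (T.lower q) ↔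
      q = L.succ p ∧ ¬ L.endpoint q.1 q.2 := by
  rw [← hT.lower_adjacent, hT.lower_endpoint]
  by_cases h : T.surface.head (T.lower p) = T.surface.tail (T.lower q)
  · rw [and_iff_right h]
    exact cut_head_eq_cut_tail_iff hT.opp_opp hT.strand_opp hT.strand_interior
      (hT.lower_boundary p) (hT.lower_boundary q) h
  · exact iff_of_false (fun h' => h (tail_eq_of_cut_tail_eq h')) fun h' => h h'.1

theorem IsTangle.upper_adjacent_cutOpen (hT : T.IsTangle) (p q : U.Pos) :
    T.cutOpen.head (T.upper p) = T.cutOpen.tail (T.upper q) ↔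
      p = U.succ q ∧ ¬ U.endpoint p.1 p.2 := by
  rw [← hT.upper_adjacent, hT.upper_endpoint]
  by_cases h : T.surface.head (T.upper p) = T.surface.tail (T.upper q)
  · rw [and_iff_right h, h]
    exact cut_head_eq_cut_tail_iff hT.opp_opp hT.strand_opp hT.strand_interior
      (hT.upper_boundary p) (hT.upper_boundary q) h
  · exact iff_of_false (fun h' => h (tail_eq_of_cut_tail_eq h')) fun h' => h h'.1

theorem IsTangle.exists_lower_of_sameArc (hT : T.IsTangle) {p : L.Pos} {d : D}
    (h : T.SameArc (T.lower p) d) : ∃ q, d = T.lower q ∧ L.arc p = L.arc q := by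
  refine exists_of_eqvGen T.lower L.arc ?_ h rfl
  rintro p x (⟨-, hx, h⟩ | ⟨hx, -, h⟩)
  · obtain rfl := hT.eq_lower_succ hx (tail_eq_of_cut_tail_eq h).symm
    exact ⟨_, rfl, (BoundaryType.arc_succ ((hT.lower_adjacent_cutOpen _ _).1 h.symm).2).symm⟩
  · obtain rfl := hT.eq_lower_pred hx (tail_eq_of_cut_tail_eq h).symm
    have := ((hT.lower_adjacent_cutOpen _ _).1 h.symm).2
    refine ⟨_, rfl, ?_⟩
    rw [← BoundaryType.arc_succ (p := L.pred p)] <;> rw [BoundaryType.succ_pred]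
    exact this

theorem IsTangle.exists_upper_of_sameArc (hT : T.IsTangle) {p : U.Pos} {d : D}
    (h : T.SameArc (T.upper p) d) : ∃ q, d = T.upper q ∧ U.arc p = U.arc q := by
  refine exists_of_eqvGen T.upper U.arc ?_ h rfl
  rintro p x (⟨-, hx, h⟩ | ⟨hx, -, h⟩)
  · obtain rfl := hT.eq_upper_pred hx (tail_eq_of_cut_tail_eq h).symm
    have := ((hT.upper_adjacent_cutOpen _ _).1 h.symm).2
    refine ⟨_, rfl, ?_⟩
    rw [← BoundaryType.arc_succ (p := U.pred p)] <;> rw [BoundaryType.succ_pred]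
    exact this
  · obtain rfl := hT.eq_upper_succ hx (tail_eq_of_cut_tail_eq h).symm
    exact ⟨_, rfl, (BoundaryType.arc_succ ((hT.upper_adjacent_cutOpen _ _).1 h.symm).2).symm⟩

theorem IsTangle.face_lower_eq_of_arc_eq (hT : T.IsTangle) {p q : L.Pos} (h : L.arc p = L.arc q) :
    T.face (T.lower p) = T.face (T.lower q) := by
  replace h : EqvGen _ p q := Quotient.exact h
  induction h with
  | rel p q h =>
    exact face_eq_of_sameArc (.rel _ _ ⟨hT.lower_boundary _, hT.lower_boundary _,
      ((hT.lower_adjacent_cutOpen p q).2 h).symm⟩)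
  | refl => rfl
  | symm _ _ _ ih => exact ih.symm
  | trans _ _ _ _ _ ih₁ ih₂ => exact ih₁.trans ih₂

theorem IsTangle.face_upper_eq_of_arc_eq (hT : T.IsTangle) {p q : U.Pos} (h : U.arc p = U.arc q) :
    T.face (T.upper p) = T.face (T.upper q) := by
  replace h : EqvGen _ p q := Quotient.exact h
  induction h with
  | rel p q h =>
    obtain ⟨rfl, hq⟩ := h
    exact face_eq_of_sameArc (.symm _ _ (.rel _ _ ⟨hT.upper_boundary _, hT.upper_boundary _,
      ((hT.upper_adjacent_cutOpen _ _).2 ⟨rfl, hq⟩).symm⟩))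
  | refl => rfl
  | symm _ _ _ ih => exact ih.symm
  | trans _ _ _ _ _ ih₁ ih₂ => exact ih₁.trans ih₂

theorem IsTangle.exists_lower_of_face_eq (hT : T.IsTangle) (hw : T.IsWellPlaced) {p : L.Pos} {d : D}
    (hd : T.surface.IsBoundary d) (h : T.face (T.lower p) = T.face d) :
    ∃ q, d = T.lower q ∧ L.arc p = L.arc q :=
  hT.exists_lower_of_sameArc (hw _ _ (hT.lower_boundary p) hd h)

theorem IsTangle.exists_upper_of_face_eq (hT : T.IsTangle) (hw : T.IsWellPlaced) {p : U.Pos} {d : D}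
    (hd : T.surface.IsBoundary d) (h : T.face (T.upper p) = T.face d) :
    ∃ q, d = T.upper q ∧ U.arc p = U.arc q :=
  hT.exists_upper_of_sameArc (hw _ _ (hT.upper_boundary p) hd h)

/-- In a well-placed tangle, the faces at the lower holes correspond to the arcs of these holes. -/
theorem IsTangle.face_lower_eq_iff (hT : T.IsTangle) (hw : T.IsWellPlaced) {p q : L.Pos} :
    T.face (T.lower p) = T.face (T.lower q) ↔ L.arc p = L.arc q := by
  refine ⟨fun h => ?_, hT.face_lower_eq_of_arc_eq⟩
  obtain ⟨r, hr, hpr⟩ := hT.exists_lower_of_face_eq hw (hT.lower_boundary q) h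
  rwa [hT.lower_injective hr]

theorem IsTangle.face_upper_eq_iff (hT : T.IsTangle) (hw : T.IsWellPlaced) {p q : U.Pos} :
    T.face (T.upper p) = T.face (T.upper q) ↔ U.arc p = U.arc q := by
  refine ⟨fun h => ?_, hT.face_upper_eq_of_arc_eq⟩
  obtain ⟨r, hr, hpr⟩ := hT.exists_upper_of_face_eq hw (hT.upper_boundary q) h
  rwa [hT.upper_injective hr]

theorem IsTangle.face_upper_ne_lower (hT : T.IsTangle) (hw : T.IsWellPlaced) (p : U.Pos)
    (q : L.Pos) : T.face (T.upper p) ≠ T.face (T.lower q) := fun h => by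
  obtain ⟨r, hr, -⟩ := hT.exists_upper_of_face_eq hw (hT.lower_boundary q) h
  exact hT.upper_ne_lower _ _ hr.symm

theorem IsTangle.sameHole_lower (hT : T.IsTangle) {p : L.Pos} {d : D} :
    T.surface.SameHole (T.lower p) d ↔ ∃ q, d = T.lower q ∧ p.1 = q.1 := by
  constructor
  · intro h
    refine exists_of_eqvGen T.lower (fun p => p.1) ?_ h rfl
    rintro p x (⟨-, hx, h⟩ | ⟨hx, -, h⟩)
    · exact ⟨_, hT.eq_lower_succ hx h.symm, rfl⟩
    · exact ⟨_, hT.eq_lower_pred hx h.symm, rfl⟩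
  · rintro ⟨q, rfl, hpq⟩
    refine BoundaryType.succ_induction (Q := fun q => T.surface.SameHole (T.lower p) (T.lower q))
      hpq (.refl _) fun r hr => .trans _ _ _ hr (.rel _ _
        ⟨hT.lower_boundary _, hT.lower_boundary _, (hT.lower_succ r).symm⟩)

theorem IsTangle.sameHole_upper (hT : T.IsTangle) {p : U.Pos} {d : D} :
    T.surface.SameHole (T.upper p) d ↔ ∃ q, d = T.upper q ∧ p.1 = q.1 := by
  constructor
  · intro h
    refine exists_of_eqvGen T.upper (fun p => p.1) ?_ h rfl
    rintro p x (⟨-, hx, h⟩ | ⟨hx, -, h⟩)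
    · exact ⟨_, hT.eq_upper_pred hx h.symm, rfl⟩
    · exact ⟨_, hT.eq_upper_succ hx h.symm, rfl⟩
  · rintro ⟨q, rfl, hpq⟩
    refine BoundaryType.succ_induction (Q := fun q => T.surface.SameHole (T.upper p) (T.upper q))
      hpq (.refl _) fun r hr => .trans _ _ _ hr (.symm _ _ (.rel _ _
        ⟨hT.upper_boundary _, hT.upper_boundary _, (hT.upper_succ r).symm⟩))

theorem IsTangle.meetsPartOfHole_lower (hT : T.IsTangle) (hw : T.IsWellPlaced) (p : L.Pos) :
    T.MeetsPartOfHole (T.face (T.lower p)) ↔ ∃ j, L.endpoint p.1 j := by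
  constructor
  · rintro ⟨d, e, hd, hde, hf, t, ht, hte⟩
    obtain ⟨q, rfl, hq⟩ := hT.exists_lower_of_face_eq hw hd hf.symm
    obtain ⟨r, rfl, hr⟩ := hT.sameHole_lower.1 hde
    rw [BoundaryType.arc_hole hq, hr]
    exact ⟨r.2, (hT.lower_endpoint r).2 ⟨t, ht, hte⟩⟩
  · rintro ⟨j, hj⟩
    exact ⟨_, _, hT.lower_boundary p, hT.sameHole_lower.2 ⟨⟨p.1, j⟩, rfl, rfl⟩, rfl,
      (hT.lower_endpoint ⟨p.1, j⟩).1 hj⟩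

theorem IsTangle.meetsPartOfHole_upper (hT : T.IsTangle) (hw : T.IsWellPlaced) (p : U.Pos) :
    T.MeetsPartOfHole (T.face (T.upper p)) ↔ ∃ j, U.endpoint p.1 j := by
  constructor
  · rintro ⟨d, e, hd, hde, hf, t, ht, hte⟩
    obtain ⟨q, rfl, hq⟩ := hT.exists_upper_of_face_eq hw hd hf.symm
    obtain ⟨r, rfl, hr⟩ := hT.sameHole_upper.1 hde
    rw [BoundaryType.arc_hole hq, hr]
    exact ⟨_, (hT.upper_endpoint (U.succ r)).2 ⟨t, ht, hte.trans (hT.upper_succ r).symm⟩⟩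
  · rintro ⟨j, hj⟩
    obtain ⟨t, ht, htj⟩ := (hT.upper_endpoint ⟨p.1, j⟩).1 hj
    refine ⟨_, _, hT.upper_boundary p,
      hT.sameHole_upper.2 ⟨U.pred ⟨p.1, j⟩, rfl, rfl⟩, rfl, t, ht, htj.trans ?_⟩
    rw [← hT.upper_succ, BoundaryType.succ_pred]

end DecoratedTangle

namespace DecoratedTangle

open PolygonGluing

/-! ### Parts of a composite tangle -/

/-- The map `ι` presents `T` as a part of the tangle diagram `S`, which is glued to the rest of `S`
along the edges of the holes in `B`. -/
structure IsPart {U L U' L' : BoundaryType} {D E : Type*} (T : DecoratedTangle U L D)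
    (S : DecoratedTangle U' L' E) (ι : D → E) (B : Set D) : Prop where
  injective : Function.Injective ι
  next : ∀ d, S.surface.next (ι d) = ι (T.surface.next d)
  opp : ∀ d ∉ B, S.surface.opp (ι d) = ι (T.surface.opp d)
  isBoundary : ∀ d, S.surface.IsBoundary (ι d) ↔ T.surface.IsBoundary d ∧ d ∉ B
  strand : ∀ d, ι d ∈ S.strand ↔ d ∈ T.strand
  overpass : ∀ d, ι d ∈ S.overpass ↔ d ∈ T.overpass
  tail : ∀ d e, S.surface.tail (ι d) = S.surface.tail (ι e) ↔ T.surface.tail d = T.surface.tail e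
  tail_cutOpen : ∀ d e, S.cutOpen.tail (ι d) = S.cutOpen.tail (ι e) ↔
    T.cutOpen.tail d = T.cutOpen.tail e
  face : ∀ d e, S.face (ι d) = S.face (ι e) ↔ T.face d = T.face e
  /-- A vertex of the part meets the rest of `S` only where it is pasted. -/
  tail_outside : ∀ d, ∀ z ∉ Set.range ι, S.surface.tail (ι d) = S.surface.tail z →
    ∃ b ∈ B, T.surface.tail d = T.surface.tail b
  /-- A face of the part meets the rest of `S` only if it is pasted. -/
  face_outside : ∀ d, ∀ z ∉ Set.range ι, S.face (ι d) = S.face z → ∃ b ∈ B, T.face d = T.face b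
  boundary : ∀ b ∈ B, T.surface.IsBoundary b
  /-- `B` is a union of holes. -/
  hole : ∀ d e, T.surface.IsBoundary d → T.surface.IsBoundary e →
    T.surface.tail e = T.surface.head d → (d ∈ B ↔ e ∈ B)

namespace IsPart

variable {U L U' L' : BoundaryType} {D E : Type*} {T : DecoratedTangle U L D}
  {S : DecoratedTangle U' L' E} {ι : D → E} {B : Set D}

theorem head (h : IsPart T S ι B) (d e : D) :
    S.surface.tail (ι e) = S.surface.head (ι d) ↔ T.surface.tail e = T.surface.head d := by
  rw [PolygonGluing.head, h.next, h.tail]; rfl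

theorem head_cutOpen (h : IsPart T S ι B) (d e : D) :
    S.cutOpen.tail (ι e) = S.cutOpen.head (ι d) ↔ T.cutOpen.tail e = T.cutOpen.head d := by
  have : S.cutOpen.next (ι d) = ι (T.cutOpen.next d) := h.next d
  rw [PolygonGluing.head, this, h.tail_cutOpen]; rfl

theorem notMem_of_strand (h : IsPart T S ι B) (hT : T.IsTangle) {d : D} (hd : d ∈ T.strand) :
    d ∉ B := fun hb => hT.strand_interior d hd (h.boundary d hb)

theorem degree_eq (h : IsPart T S ι B) {d : D}
    (hd : ∀ b ∈ B, T.surface.tail d ≠ T.surface.tail b) :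
    S.degree (S.surface.tail (ι d)) = T.degree (T.surface.tail d) := by
  have : {x ∈ S.strand | S.surface.tail x = S.surface.tail (ι d)} =
      ι '' {x ∈ T.strand | T.surface.tail x = T.surface.tail d} := by
    ext x
    constructor
    · rintro ⟨hx, hxd⟩
      by_cases hr : x ∈ Set.range ι
      · obtain ⟨y, rfl⟩ := hr
        exact ⟨y, ⟨(h.strand y).1 hx, (h.tail _ _).1 hxd⟩, rfl⟩
      · obtain ⟨b, hb, hdb⟩ := h.tail_outside d x hr hxd.symm
        exact absurd hdb (hd b hb)
    · rintro ⟨y, ⟨hy, hyd⟩, rfl⟩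
      exact ⟨(h.strand y).2 hy, (h.tail _ _).2 hyd⟩
  rw [degree, this, Set.ncard_image_of_injective _ h.injective, degree]

theorem degree_boundary (h : IsPart T S ι B) (hT : T.IsTangle) {d : D}
    (hd : S.surface.IsBoundary (ι d)) : S.degree (S.surface.tail (ι d)) ≤ 1 := by
  obtain ⟨h₁, h₂⟩ := (h.isBoundary d).1 hd
  rw [h.degree_eq fun b hb hdb => h₂ (eq_of_tail_eq h₁ (h.boundary b hb) hdb ▸ hb)]
  exact hT.degree_boundary d h₁

theorem degree_interior (h : IsPart T S ι B) (hT : T.IsTangle) {d : D}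
    (hd : ∀ b ∈ B, T.surface.tail d ≠ T.surface.tail b)
    (hd' : ∀ x, S.surface.IsBoundary x → S.surface.tail x ≠ S.surface.tail (ι d)) :
    S.degree (S.surface.tail (ι d)) = 0 ∨ S.degree (S.surface.tail (ι d)) = 2 ∨
      S.degree (S.surface.tail (ι d)) = 4 := by
  rw [h.degree_eq hd]
  refine hT.degree_interior _ fun e he hed => ?_
  by_cases heB : e ∈ B
  · exact hd e heB hed.symm
  · exact hd' (ι e) ((h.isBoundary e).2 ⟨he, heB⟩) ((h.tail _ _).2 hed)

theorem over_alternates (h : IsPart T S ι B) (hT : T.IsTangle)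
    (hS : ∀ x ∈ S.strand, ¬ S.surface.IsBoundary x) {d : D} {e : E}
    (hd : ∀ b ∈ B, T.surface.tail d ≠ T.surface.tail b) (hds : ι d ∈ S.strand) (hes : e ∈ S.strand)
    (h4 : S.degree (S.surface.tail (ι d)) = 4)
    (hde : S.cutOpen.tail (ι d) = S.cutOpen.head (S.surface.opp e)) :
    ι d ∈ S.overpass ↔ e ∉ S.overpass := by
  by_cases hr : e ∈ Set.range ι
  · obtain ⟨e, rfl⟩ := hr
    have heT := (h.strand e).1 hes
    rw [h.opp e (h.notMem_of_strand hT heT), h.head_cutOpen] at hde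
    rw [h.degree_eq hd] at h4
    rw [h.overpass, h.overpass]
    exact hT.over_alternates d ((h.strand d).1 hds) e heT h4 hde
  · obtain ⟨b, hb, hdb⟩ := h.tail_outside d e hr
      ((tail_eq_of_cut_tail_eq hde).trans (tail_next_opp (hS e hes)))
    exact absurd hdb (hd b hb)

/-- A path along the boundary of `T` that starts outside the holes in `B` is a path along the
boundary of `S`. -/
theorem sameArc (h : IsPart T S ι B) {d e : D} (hd : d ∉ B) (hde : T.SameArc d e) :
    S.SameArc (ι d) (ι e) := by
  suffices H : (d ∈ B ↔ e ∈ B) ∧ (d ∉ B → S.SameArc (ι d) (ι e)) from H.2 hd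
  clear hd
  induction hde with
  | rel d e hde =>
    obtain ⟨h₁, h₂, h₃⟩ := hde
    have h₄ := h.hole d e h₁ h₂ (tail_eq_of_cut_tail_eq h₃)
    exact ⟨h₄, fun hd => .rel _ _ ⟨(h.isBoundary d).2 ⟨h₁, hd⟩,
      (h.isBoundary e).2 ⟨h₂, h₄.not.1 hd⟩, (h.head_cutOpen d e).2 h₃⟩⟩
  | refl => exact ⟨Iff.rfl, fun _ => .refl _⟩
  | symm _ _ _ ih => exact ⟨ih.1.symm, fun hd => .symm _ _ (ih.2 (ih.1.not.2 hd))⟩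
  | trans _ _ _ _ _ ih₁ ih₂ =>
    exact ⟨ih₁.1.trans ih₂.1, fun hd => .trans _ _ _ (ih₁.2 hd) (ih₂.2 (ih₁.1.not.1 hd))⟩

theorem sameHole (h : IsPart T S ι B) {d : D} (hd : T.surface.IsBoundary d) (hdB : d ∉ B) {z : E} :
    S.surface.SameHole (ι d) z ↔ ∃ e, z = ι e ∧ e ∉ B ∧ T.surface.SameHole d e := by
  constructor
  · intro hz
    let r : D → D → Prop := fun d e => T.surface.IsBoundary d ∧
      T.surface.IsBoundary e ∧ T.surface.tail e = T.surface.head d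
    have hr : ∀ {x y}, r x y → Quotient.mk (EqvGen.setoid r) x = Quotient.mk (EqvGen.setoid r) y :=
      fun h => Quotient.sound (EqvGen.rel _ _ h)
    obtain ⟨⟨e, _, he⟩, rfl, hde⟩ := exists_of_eqvGen
      (fun x : {x // T.surface.IsBoundary x ∧ x ∉ B} => ι x)
      (fun x => Quotient.mk (EqvGen.setoid r) x.1) (by
      rintro ⟨x, hx, hxB⟩ z (⟨-, hz, hxz⟩ | ⟨hz, -, hxz⟩) <;> by_cases hzr : z ∈ Set.range ι
      · obtain ⟨z, rfl⟩ := hzr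
        exact ⟨⟨z, (h.isBoundary z).1 hz⟩, rfl,
          hr ⟨hx, ((h.isBoundary z).1 hz).1, (h.head _ _).1 hxz⟩⟩
      · rw [PolygonGluing.head, h.next] at hxz
        obtain ⟨b, hb, hxb⟩ := h.tail_outside _ z hzr hxz.symm
        exact absurd ((h.hole x b hx (h.boundary b hb) hxb.symm).2 hb) hxB
      · obtain ⟨z, rfl⟩ := hzr
        exact ⟨⟨z, (h.isBoundary z).1 hz⟩, rfl,
          (hr ⟨((h.isBoundary z).1 hz).1, hx, (h.head _ _).1 hxz⟩).symm⟩
      · have hn : S.surface.next z ∉ Set.range ι := by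
          rintro ⟨y, hy⟩
          refine hzr ⟨T.surface.next.symm y, S.surface.next.injective ?_⟩
          rw [h.next, Equiv.apply_symm_apply, hy]
        obtain ⟨b, hb, hxb⟩ := h.tail_outside _ _ hn hxz
        exact absurd (eq_of_tail_eq hx (h.boundary b hb) hxb ▸ hb) hxB) hz
      (p := ⟨d, hd, hdB⟩) rfl
    exact ⟨e, rfl, he, Quotient.exact hde⟩
  · rintro ⟨e, rfl, -, hde⟩
    suffices H : (d ∈ B ↔ e ∈ B) ∧ (d ∉ B → S.surface.SameHole (ι d) (ι e)) from H.2 hdB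
    clear hdB hd
    induction hde with
    | rel d e hde =>
      obtain ⟨h₁, h₂, h₃⟩ := hde
      have h₄ := h.hole d e h₁ h₂ h₃
      exact ⟨h₄, fun hd => .rel _ _ ⟨(h.isBoundary d).2 ⟨h₁, hd⟩,
        (h.isBoundary e).2 ⟨h₂, h₄.not.1 hd⟩, (h.head d e).2 h₃⟩⟩
    | refl => exact ⟨Iff.rfl, fun _ => .refl _⟩
    | symm _ _ _ ih => exact ⟨ih.1.symm, fun hd => .symm _ _ (ih.2 (ih.1.not.2 hd))⟩
    | trans _ _ _ _ _ ih₁ ih₂ =>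
      exact ⟨ih₁.1.trans ih₂.1, fun hd => .trans _ _ _ (ih₁.2 hd) (ih₂.2 (ih₁.1.not.1 hd))⟩

theorem meetsPartOfHole (h : IsPart T S ι B) {d : D} (hd : ∀ b ∈ B, T.face d ≠ T.face b) :
    S.MeetsPartOfHole (S.face (ι d)) ↔ T.MeetsPartOfHole (T.face d) := by
  constructor
  · rintro ⟨x, y, hx, hxy, hxd, t, ht, hty⟩
    by_cases hr : x ∈ Set.range ι
    · obtain ⟨x, rfl⟩ := hr
      obtain ⟨hx₁, hx₂⟩ := (h.isBoundary x).1 hx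
      obtain ⟨y, rfl, hyB, hxy⟩ := (h.sameHole hx₁ hx₂).1 hxy
      have hy := (isBoundary_of_sameHole hxy).1 hx₁
      by_cases htr : t ∈ Set.range ι
      · obtain ⟨t, rfl⟩ := htr
        exact ⟨x, y, hx₁, hxy, (h.face _ _).1 hxd, t, (h.strand t).1 ht, (h.tail _ _).1 hty⟩
      · obtain ⟨b, hb, hyb⟩ := h.tail_outside y t htr hty.symm
        exact absurd (eq_of_tail_eq hy (h.boundary b hb) hyb ▸ hb) hyB
    · obtain ⟨b, hb, hdb⟩ := h.face_outside d x hr hxd.symm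
      exact absurd hdb (hd b hb)
  · rintro ⟨x, y, hx, hxy, hxd, t, ht, hty⟩
    have hxB : x ∉ B := fun hb => hd x hb hxd.symm
    have hyB : y ∉ B := by
      intro hyB
      suffices H : x ∈ B ↔ y ∈ B from hxB (H.2 hyB)
      clear hyB hxB hty hx hxd
      induction hxy with
      | rel d e h' => exact h.hole d e h'.1 h'.2.1 h'.2.2
      | refl => rfl
      | symm _ _ _ ih => exact ih.symm
      | trans _ _ _ _ _ ih₁ ih₂ => exact ih₁.trans ih₂
    exact ⟨ι x, ι y, (h.isBoundary x).2 ⟨hx, hxB⟩, (h.sameHole hx hxB).2 ⟨y, rfl, hyB, hxy⟩,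
      (h.face _ _).2 hxd, ι t, (h.strand t).2 ht, (h.tail _ _).2 hty⟩

end IsPart

/-! ### Composites of well-placed tangles -/

variable {U V L : BoundaryType} {D D' : Type*} {T : DecoratedTangle U V D}
  {T' : DecoratedTangle V L D'}

theorem gluable_surface (hT : T.IsTangle) (hT' : T'.IsTangle) :
    Gluable T.surface T'.surface T.lower T'.upper where
  left_involutive := hT.opp_opp
  right_involutive := hT'.opp_opp
  left_boundary := hT.lower_boundary
  right_boundary := hT'.upper_boundary
  left_injective := hT.lower_injective
  right_injective := hT'.upper_injective
  adjacent p q := by rw [hT.lower_adjacent, hT'.upper_adjacent]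

theorem gluable_cutOpen (hT : T.IsTangle) (hT' : T'.IsTangle) :
    Gluable T.cutOpen T'.cutOpen T.lower T'.upper where
  left_involutive := hT.cutOpen_involutive
  right_involutive := hT'.cutOpen_involutive
  left_boundary p := cutOpen_isBoundary (hT.lower_boundary p)
  right_boundary p := cutOpen_isBoundary (hT'.upper_boundary p)
  left_injective := hT.lower_injective
  right_injective := hT'.upper_injective
  adjacent p q := by rw [hT.lower_adjacent_cutOpen, hT'.upper_adjacent_cutOpen]

theorem comp_surface : (T'.comp T).surface = glue T.surface T'.surface T.lower T'.upper := by
  unfold comp glue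
  congr!

/-- Cutting along the tangle commutes with pasting. -/
theorem comp_cutOpen (hT : T.IsTangle) (hT' : T'.IsTangle) :
    (T'.comp T).cutOpen = glue T.cutOpen T'.cutOpen T.lower T'.upper := by
  have hg := gluable_surface hT hT'
  have hc := gluable_cutOpen hT hT'
  have key : (T'.comp T).cutOpen.opp = (glue T.cutOpen T'.cutOpen T.lower T'.upper).opp := by
    funext x
    rcases x with d | d
    · by_cases hd : d ∈ T.strand
      · have h₁ : d ∉ Set.range T.lower := by
          rintro ⟨p, rfl⟩
          exact hT.strand_interior _ hd (hT.lower_boundary p)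
        rw [glue_opp_inl h₁]
        simp [cutOpen, cut, comp, hd]
      · have h₁ : Sum.inl d ∉ (T'.comp T).strand := by simp [comp, hd]
        rw [cutOpen, cut_opp_of_notMem h₁, comp_surface]
        by_cases hr : d ∈ Set.range T.lower
        · obtain ⟨p, rfl⟩ := hr
          rw [hg.opp_left, hc.opp_left]
        · rw [glue_opp_inl hr, glue_opp_inl hr, cutOpen, cut_opp_of_notMem hd]
    · by_cases hd : d ∈ T'.strand
      · have h₁ : d ∉ Set.range T'.upper := by
          rintro ⟨p, rfl⟩
          exact hT'.strand_interior _ hd (hT'.upper_boundary p)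
        rw [glue_opp_inr h₁]
        simp [cutOpen, cut, comp, hd]
      · have h₁ : Sum.inr d ∉ (T'.comp T).strand := by simp [comp, hd]
        rw [cutOpen, cut_opp_of_notMem h₁, comp_surface]
        by_cases hr : d ∈ Set.range T'.upper
        · obtain ⟨p, rfl⟩ := hr
          rw [hg.opp_right, hc.opp_right]
        · rw [glue_opp_inr hr, glue_opp_inr hr, cutOpen, cut_opp_of_notMem hd]
  have : (T'.comp T).cutOpen = ⟨(glue T.cutOpen T'.cutOpen T.lower T'.upper).next,
      (T'.comp T).cutOpen.opp⟩ := rfl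
  rw [this, key]

/-- On the uncut surface the ends of the pasted edges are also starting points of pasted edges, so that
pasting the starting points of the edges `T.lower p` already accounts for all identifications. -/
theorem comp_tail (hT : T.IsTangle) (hT' : T'.IsTangle) :
    GluesAlong T.surface.tail T'.surface.tail (T'.comp T).surface.tail
      T.lower (T'.surface.next ∘ T'.upper) := by
  have h := (gluable_surface hT hT').tail
  rw [← comp_surface] at h
  refine ⟨h.inl_inl, h.inr_inr, fun x y => (h.inl_inr x y).trans ?_⟩
  constructor
  · rintro ⟨p | p, hx, hy⟩
    · exact ⟨p, hx, hy⟩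
    · refine ⟨V.succ p, hx.trans (hT.lower_succ p), hy.trans (hT'.upper_succ p).symm⟩
  · rintro ⟨p, hx, hy⟩
    exact ⟨.inl p, hx, hy⟩

theorem comp_tail_cutOpen (hT : T.IsTangle) (hT' : T'.IsTangle) :
    GluesAlong T.cutOpen.tail T'.cutOpen.tail (T'.comp T).cutOpen.tail
      (Sum.elim T.lower (T.surface.next ∘ T.lower))
      (Sum.elim (T'.surface.next ∘ T'.upper) T'.upper) := by
  rw [comp_cutOpen hT hT']
  exact (gluable_cutOpen hT hT').tail

theorem face_lower_eq_iff_face_upper_eq (hT : T.IsTangle) (hT' : T'.IsTangle)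
    (hw : T.IsWellPlaced) (hw' : T'.IsWellPlaced) (p q : V.Pos) :
    T.face (T.lower p) = T.face (T.lower q) ↔ T'.face (T'.upper p) = T'.face (T'.upper q) := by
  rw [hT.face_lower_eq_iff hw, hT'.face_upper_eq_iff hw']

/-- A face of `T` at a lower hole is pasted to just one face of `T'`, and conversely, as both
correspond to the same arc. -/
theorem comp_face (hT : T.IsTangle) (hT' : T'.IsTangle)
    (hw : T.IsWellPlaced) (hw' : T'.IsWellPlaced) :
    GluesAlong T.face T'.face (T'.comp T).face T.lower T'.upper := by
  have := (gluable_cutOpen hT hT').component (face_lower_eq_iff_face_upper_eq hT hT' hw hw')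
  rw [← comp_cutOpen hT hT'] at this
  exact this

/-- `T` is the part of the composite that is pasted along the lower holes of `T`. -/
theorem comp_left (hT : T.IsTangle) (hT' : T'.IsTangle)
    (hw : T.IsWellPlaced) (hw' : T'.IsWellPlaced) :
    IsPart T (T'.comp T) Sum.inl (Set.range T.lower) where
  injective := Sum.inl_injective
  next _ := rfl
  opp _ hd := by rw [comp_surface]; exact glue_opp_inl hd
  isBoundary _ := by rw [comp_surface]; exact (gluable_surface hT hT').isBoundary_inl
  strand d := by simp [comp]
  overpass d := by simp [comp]
  tail := (comp_tail hT hT').inl_inl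
  tail_cutOpen := (comp_tail_cutOpen hT hT').inl_inl
  face := (comp_face hT hT' hw hw').inl_inl
  tail_outside := by
    rintro d (z | z) hz h
    · exact absurd ⟨z, rfl⟩ hz
    · obtain ⟨p, hp, -⟩ := ((comp_tail hT hT').inl_inr d z).1 h
      exact ⟨_, ⟨p, rfl⟩, hp⟩
  face_outside := by
    rintro d (z | z) hz h
    · exact absurd ⟨z, rfl⟩ hz
    · obtain ⟨p, hp, -⟩ := ((comp_face hT hT' hw hw').inl_inr d z).1 h
      exact ⟨_, ⟨p, rfl⟩, hp⟩
  boundary := by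
    rintro _ ⟨p, rfl⟩
    exact hT.lower_boundary p
  hole := by
    intro d e hd he h
    constructor
    · rintro ⟨p, rfl⟩
      exact ⟨_, (hT.eq_lower_succ he h.symm).symm⟩
    · rintro ⟨p, rfl⟩
      exact ⟨_, (hT.eq_lower_pred hd h.symm).symm⟩

/-- `T'` is the part of the composite that is pasted along the upper holes of `T'`. -/
theorem comp_right (hT : T.IsTangle) (hT' : T'.IsTangle)
    (hw : T.IsWellPlaced) (hw' : T'.IsWellPlaced) :
    IsPart T' (T'.comp T) Sum.inr (Set.range T'.upper) where
  injective := Sum.inr_injective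
  next _ := rfl
  opp _ hd := by rw [comp_surface]; exact glue_opp_inr hd
  isBoundary _ := by rw [comp_surface]; exact (gluable_surface hT hT').isBoundary_inr
  strand d := by simp [comp]
  overpass d := by simp [comp]
  tail := (comp_tail hT hT').inr_inr
  tail_cutOpen := (comp_tail_cutOpen hT hT').inr_inr
  face := (comp_face hT hT' hw hw').inr_inr
  tail_outside := by
    rintro d (z | z) hz h
    · obtain ⟨p, -, hp⟩ := ((comp_tail hT hT').inl_inr z d).1 h.symm
      refine ⟨_, ⟨V.pred p, rfl⟩, hp.trans ?_⟩
      rw [← hT'.upper_succ, BoundaryType.succ_pred]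
      rfl
    · exact absurd ⟨z, rfl⟩ hz
  face_outside := by
    rintro d (z | z) hz h
    · obtain ⟨p, -, hp⟩ := ((comp_face hT hT' hw hw').inl_inr z d).1 h.symm
      exact ⟨_, ⟨p, rfl⟩, hp⟩
    · exact absurd ⟨z, rfl⟩ hz
  boundary := by
    rintro _ ⟨p, rfl⟩
    exact hT'.upper_boundary p
  hole := by
    intro d e hd he h
    constructor
    · rintro ⟨p, rfl⟩
      exact ⟨_, (hT'.eq_upper_pred he h.symm).symm⟩
    · rintro ⟨p, rfl⟩
      exact ⟨_, (hT'.eq_upper_succ hd h.symm).symm⟩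

end DecoratedTangle

namespace DecoratedTangle

open PolygonGluing

variable {U V L : BoundaryType} {D D' : Type*} {T : DecoratedTangle U V D}
  {T' : DecoratedTangle V L D'}

theorem IsTangle.tail_lower_ne_tail_upper (hT' : T'.IsTangle) (p : L.Pos) (q : V.Pos) :
    T'.surface.tail (T'.lower p) ≠ T'.surface.tail (T'.upper q) := fun h =>
  hT'.upper_ne_lower _ _ (eq_of_tail_eq (hT'.lower_boundary p) (hT'.upper_boundary q) h).symm

/-- A vertex at which `T` and `T'` are pasted is one where a curve of `T` is joined to a curve of
`T'`, or it does not lie on the tangle. -/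
theorem degree_glued [Finite D] [Finite D'] (hT : T.IsTangle) (hT' : T'.IsTangle) (p : V.Pos) :
    (T'.comp T).degree ((T'.comp T).surface.tail (.inl (T.lower p))) = 0 ∨
      (T'.comp T).degree ((T'.comp T).surface.tail (.inl (T.lower p))) = 2 := by
  have h := comp_tail hT hT'
  have hp : T'.surface.head (T'.upper p) = T'.surface.tail (T'.upper (V.pred p)) := by
    rw [← hT'.upper_succ, BoundaryType.succ_pred]
  have key : ∀ x, (T'.comp T).surface.tail (.inr x) =
      (T'.comp T).surface.tail (.inl (T.lower p)) ↔
        T'.surface.tail x = T'.surface.head (T'.upper p) := by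
    intro x
    rw [eq_comm, h.inl_inr]
    constructor
    · rintro ⟨q, hq, hx⟩
      obtain rfl := hT.lower_injective
        (eq_of_tail_eq (hT.lower_boundary p) (hT.lower_boundary q) hq)
      exact hx
    · exact fun hx => ⟨p, rfl, hx⟩
  have h₁ : {x ∈ (T'.comp T).strand |
      (T'.comp T).surface.tail x = (T'.comp T).surface.tail (.inl (T.lower p))} =
      Sum.inl '' {x ∈ T.strand | T.surface.tail x = T.surface.tail (T.lower p)} ∪
      Sum.inr '' {x ∈ T'.strand | T'.surface.tail x = T'.surface.head (T'.upper p)} := by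
    ext (x | x)
    · simp [comp, ← h.inl_inl]
    · simp [comp, ← key]
  have h₂ : (T'.comp T).degree ((T'.comp T).surface.tail (.inl (T.lower p))) =
      T.degree (T.surface.tail (T.lower p)) + T'.degree (T'.surface.head (T'.upper p)) := by
    rw [degree, h₁, Set.ncard_union_eq, Set.ncard_image_of_injective _ Sum.inl_injective,
      Set.ncard_image_of_injective _ Sum.inr_injective, degree, degree]
    rw [Set.disjoint_left]
    rintro _ ⟨x, -, rfl⟩ ⟨y, -, hy⟩
    simp at hy
  have h₃ := hT.degree_boundary _ (hT.lower_boundary p)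
  have h₄ := hT'.degree_boundary _ (hT'.upper_boundary (V.pred p))
  rw [← hp] at h₄
  have h₅ : 0 < T.degree (T.surface.tail (T.lower p)) ↔
      0 < T'.degree (T'.surface.head (T'.upper p)) := by
    rw [degree, degree, Set.ncard_pos, Set.ncard_pos]
    exact (hT.lower_endpoint p).symm.trans (hT'.upper_endpoint p)
  omega

/-- A vertex of `T'` lies on a pasted hole, or else it avoids all upper holes of `T'`. -/
theorem comp_tail_inr_cases (hT : T.IsTangle) (hT' : T'.IsTangle) (d : D') :
    (∃ p, (T'.comp T).surface.tail (.inr d) = (T'.comp T).surface.tail (.inl (T.lower p))) ∨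
      ∀ b ∈ Set.range T'.upper, T'.surface.tail d ≠ T'.surface.tail b := by
  by_cases h : ∃ p, T'.surface.tail d = T'.surface.tail (T'.upper p)
  · obtain ⟨p, hp⟩ := h
    refine .inl ⟨V.succ p, Eq.symm (((comp_tail hT hT').inl_inr _ _).2 ⟨V.succ p, rfl, ?_⟩)⟩
    exact hp.trans (hT'.upper_succ p).symm
  · refine .inr ?_
    rintro _ ⟨p, rfl⟩ hp
    exact h ⟨p, hp⟩

/-- A vertex of `T` lies on a pasted hole, or else it avoids all lower holes of `T`. -/
theorem comp_tail_inl_cases (hT : T.IsTangle) (hT' : T'.IsTangle) (d : D) :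
    (∃ p, (T'.comp T).surface.tail (.inl d) = (T'.comp T).surface.tail (.inl (T.lower p))) ∨
      ∀ b ∈ Set.range T.lower, T.surface.tail d ≠ T.surface.tail b := by
  by_cases h : ∃ p, T.surface.tail d = T.surface.tail (T.lower p)
  · obtain ⟨p, hp⟩ := h
    exact .inl ⟨p, ((comp_tail hT hT').inl_inl _ _).2 hp⟩
  · refine .inr ?_
    rintro _ ⟨p, rfl⟩ hp
    exact h ⟨p, hp⟩

theorem comp_isTangle [Finite D] [Finite D'] (hT : T.IsTangle) (hT' : T'.IsTangle)
    (hw : T.IsWellPlaced) (hw' : T'.IsWellPlaced) : (T'.comp T).IsTangle := by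
  have hl := comp_left hT hT' hw hw'
  have hr := comp_right hT hT' hw hw'
  have hs := gluable_surface hT hT'
  have strand_interior : ∀ d ∈ (T'.comp T).strand, ¬ (T'.comp T).surface.IsBoundary d := by
    rintro (d | d) hd hb
    · exact hT.strand_interior d ((hl.strand d).1 hd) ((hl.isBoundary d).1 hb).1
    · exact hT'.strand_interior d ((hr.strand d).1 hd) ((hr.isBoundary d).1 hb).1
  exact
  { opp_opp := by
      rw [comp_surface]
      exact hs.involutive
    strand_interior := strand_interior
    strand_opp := by
      rintro (d | d) hd
      · have hd' := (hl.strand d).1 hd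
        rw [hl.opp d (hl.notMem_of_strand hT hd'), hl.strand]
        exact hT.strand_opp d hd'
      · have hd' := (hr.strand d).1 hd
        rw [hr.opp d (hr.notMem_of_strand hT' hd'), hr.strand]
        exact hT'.strand_opp d hd'
    degree_boundary := by
      rintro (d | d) hd
      · exact hl.degree_boundary hT hd
      · exact hr.degree_boundary hT' hd
    degree_interior := by
      intro v hv
      obtain ⟨d | d, rfl⟩ : ∃ d, (T'.comp T).surface.tail d = v := Quotient.exists_rep v
      · obtain ⟨p, hp⟩ | hd := comp_tail_inl_cases hT hT' d
        · rw [hp]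
          have := degree_glued hT hT' p
          tauto
        · exact hl.degree_interior hT hd hv
      · obtain ⟨p, hp⟩ | hd := comp_tail_inr_cases hT hT' d
        · rw [hp]
          have := degree_glued hT hT' p
          tauto
        · exact hr.degree_interior hT' hd hv
    over_alternates := by
      rintro (d | d) hd e he h4 hde
      · obtain ⟨p, hp⟩ | hd' := comp_tail_inl_cases hT hT' d
        · rw [hp] at h4
          have := degree_glued hT hT' p
          omega
        · exact hl.over_alternates hT strand_interior hd' hd he h4 hde
      · obtain ⟨p, hp⟩ | hd' := comp_tail_inr_cases hT hT' d
        · rw [hp] at h4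
          have := degree_glued hT hT' p
          omega
        · exact hr.over_alternates hT' strand_interior hd' hd he h4 hde
    injective := by
      rintro (p | p) (q | q) h
      · rw [hT.upper_injective (Sum.inl_injective h)]
      · simp [comp] at h
      · simp [comp] at h
      · rw [hT'.lower_injective (Sum.inr_injective h)]
    lower_boundary := fun p => (hr.isBoundary _).2 ⟨hT'.lower_boundary p, by
      rintro ⟨q, hq⟩
      exact hT'.upper_ne_lower _ _ hq⟩
    lower_succ := fun p => ((hr.head _ _).2 (hT'.lower_succ p).symm).symm
    lower_endpoint := by
      intro p
      rw [hT'.lower_endpoint]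
      constructor
      · rintro ⟨t, ht, htp⟩
        exact ⟨.inr t, (hr.strand t).2 ht, (hr.tail _ _).2 htp⟩
      · rintro ⟨t | t, ht, htp⟩
        · obtain ⟨_, ⟨q, rfl⟩, hq⟩ := hr.tail_outside (T'.lower p) (.inl t) (by simp) htp.symm
          exact absurd hq (hT'.tail_lower_ne_tail_upper p q)
        · exact ⟨t, (hr.strand t).1 ht, (hr.tail _ _).1 htp⟩
    upper_boundary := fun p => (hl.isBoundary _).2 ⟨hT.upper_boundary p, by
      rintro ⟨q, hq⟩
      exact hT.upper_ne_lower _ _ hq.symm⟩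
    upper_succ := fun p => ((hl.head _ _).2 (hT.upper_succ p).symm).symm
    upper_endpoint := by
      intro p
      rw [hT.upper_endpoint]
      constructor
      · rintro ⟨t, ht, htp⟩
        exact ⟨.inl t, (hl.strand t).2 ht, (hl.head _ _).2 htp⟩
      · rintro ⟨t | t, ht, htp⟩
        · exact ⟨t, (hl.strand t).1 ht, (hl.head _ _).1 htp⟩
        · obtain ⟨_, ⟨q, rfl⟩, hq⟩ := hl.tail_outside (T.surface.next (T.upper p)) (.inr t)
            (by simp) htp.symm
          exact absurd (hT.eq_lower_pred (hT.upper_boundary p) hq) (hT.upper_ne_lower _ _) }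

/-- The faces of the composite that meet its boundary are faces of `T` or of `T'` that are not
pasted. -/
theorem comp_isWellPlaced (hT : T.IsTangle) (hT' : T'.IsTangle)
    (hw : T.IsWellPlaced) (hw' : T'.IsWellPlaced) : (T'.comp T).IsWellPlaced := by
  have hl := comp_left hT hT' hw hw'
  have hr := comp_right hT hT' hw hw'
  have hne : ∀ d e, (T'.comp T).surface.IsBoundary (.inl d) →
      (T'.comp T).face (.inl d) ≠ (T'.comp T).face (.inr e) := by
    intro d e hd hde
    obtain ⟨p, hp, -⟩ := ((comp_face hT hT' hw hw').inl_inr d e).1 hde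
    obtain ⟨q, rfl, -⟩ := hT.exists_lower_of_face_eq hw ((hl.isBoundary d).1 hd).1 hp.symm
    exact ((hl.isBoundary _).1 hd).2 ⟨q, rfl⟩
  rintro (d | d) (e | e) hd he hde
  · have hd := (hl.isBoundary d).1 hd
    have he := (hl.isBoundary e).1 he
    exact hl.sameArc hd.2 (hw d e hd.1 he.1 ((hl.face d e).1 hde))
  · exact absurd hde (hne d e hd)
  · exact absurd hde.symm (hne e d he)
  · have hd := (hr.isBoundary d).1 hd
    have he := (hr.isBoundary e).1 he
    exact hr.sameArc hd.2 (hw' d e hd.1 he.1 ((hr.face d e).1 hde))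

end DecoratedTangle

namespace DecoratedTangle

open PolygonGluing

/-! ### State values of composites -/

section

variable {U L U' L' : BoundaryType} {D E : Type*}
  {T : DecoratedTangle U L D} {S : DecoratedTangle U' L' E} {ι : D → E} {B : Set D}
  {C R A : Type*} [CommRing R] [CommRing A] [Algebra R A] {W : FacialVariables C R A}

theorem contribution_congr {f : T.Face} {g : S.Face}
    (h : S.MeetsPartOfHole g ↔ T.MeetsPartOfHole f)
    (h' : S.cutOpen.eulerChar g = T.cutOpen.eulerChar f) (i : C) :
    S.contribution W g i = T.contribution W f i := by
  by_cases hf : T.MeetsPartOfHole f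
  · rw [contribution, contribution, if_pos hf, if_pos (h.2 hf), h']
  · rw [contribution, contribution, if_neg hf, if_neg (h.not.2 hf), h']

/-- The map from the faces of a part of a tangle to the faces of the tangle. -/
noncomputable def IsPart.faceMap (h : IsPart T S ι B) : T.Face → S.Face :=
  Quotient.lift (fun d => S.face (ι d)) fun d e hde => (h.face d e).2 (Quotient.sound hde)

@[simp] theorem IsPart.faceMap_face (h : IsPart T S ι B) (d : D) :
    h.faceMap (T.face d) = S.face (ι d) := rfl

theorem IsPart.faceMap_injective (h : IsPart T S ι B) : Function.Injective h.faceMap := by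
  rintro ⟨d⟩ ⟨e⟩ hde
  exact (h.face d e).1 hde

theorem mem_crossings [Fintype D] {z : Sym2 D} : z ∈ T.crossings ↔
    ∃ d e, z = s(d, e) ∧ d ≠ e ∧ T.surface.tail d = T.surface.tail e ∧
    T.degree (T.surface.tail d) = 4 ∧ d ∈ T.strand ∩ T.overpass ∧ e ∈ T.strand ∩ T.overpass := by
  simp [crossings]

theorem IsPart.crossingValue_map [Fintype D] (h : IsPart T S ι B) (hT : T.IsTangle) (σ : S.Face → C)
    {z : Sym2 D} (hz : z ∈ T.crossings) :
    S.crossingValue W σ (z.map ι) = T.crossingValue W (σ ∘ h.faceMap) z := by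
  obtain ⟨d, e, rfl, -, -, -, hd, he⟩ := mem_crossings.1 hz
  simp [crossingValue, h.opp d (h.notMem_of_strand hT hd.1), h.opp e (h.notMem_of_strand hT he.1)]

theorem IsPart.isAdmissible (h : IsPart T S ι B) (hT : T.IsTangle) {P : Type*} {b : P → D}
    (hb : ∀ p, ∀ x ∈ B, T.face (b p) ≠ T.face x) {c : P → C} :
    S.IsAdmissible W (fun p => ι (b p)) c ↔ T.IsAdmissible W b c := by
  refine and_congr (by simp only [h.face]) ⟨fun H d hd p q hp hq => ?_, fun H d hd p q hp hq => ?_⟩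
  · refine H (ι d) ((h.strand d).2 hd) p q ((h.face _ _).2 hp) ?_
    rw [h.opp d (h.notMem_of_strand hT hd)]
    exact (h.face _ _).2 hq
  · by_cases hr : d ∈ Set.range ι
    · obtain ⟨d, rfl⟩ := hr
      have hd := (h.strand d).1 hd
      rw [h.opp d (h.notMem_of_strand hT hd)] at hq
      exact H d hd p q ((h.face _ _).1 hp) ((h.face _ _).1 hq)
    · obtain ⟨x, hx, hpx⟩ := h.face_outside _ d hr hp.symm
      exact absurd hpx (hb p x hx)

theorem isAdmissible_of_not_isForbidden {σ : T.Face → C} (h : ¬ T.IsForbidden W σ) {P : Type*}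
    {b : P → D} {c : P → C} (hc : ∀ p, σ (T.face (b p)) = c p) : T.IsAdmissible W b c := by
  refine ⟨fun p q hpq => by rw [← hc, ← hc, hpq], fun d hd p q hp hq hf => h ⟨d, hd, ?_⟩⟩
  rwa [hp, hq, hc, hc]

variable [Fintype D] [Fintype C]

theorem evaluation_eq_zero_of_notMem_upperStates {lam : L.Pos → C} {ups : U.Pos → C}
    (h : ups ∉ T.upperStates W) : T.evaluation W lam ups = 0 := by
  refine Finset.sum_eq_zero fun σ _ => ?_
  split_ifs with hσ
  · refine if_pos ?_
    by_contra hf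
    exact h (by simpa [upperStates] using isAdmissible_of_not_isForbidden hf hσ.2)
  · rfl

theorem evaluation_eq_zero_of_notMem_lowerStates {lam : L.Pos → C} {ups : U.Pos → C}
    (h : lam ∉ T.lowerStates W) : T.evaluation W lam ups = 0 := by
  refine Finset.sum_eq_zero fun σ _ => ?_
  split_ifs with hσ
  · refine if_pos ?_
    by_contra hf
    exact h (by simpa [lowerStates] using isAdmissible_of_not_isForbidden hf hσ.1)
  · rfl

end

variable {U V L : BoundaryType} {D D' : Type*} {T : DecoratedTangle U V D}
  {T' : DecoratedTangle V L D'} {C R A : Type*} [CommRing R] [CommRing A] [Algebra R A]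
  {W : FacialVariables C R A}

theorem comp_not_meetsPartOfHole_glued (hT : T.IsTangle) (hT' : T'.IsTangle)
    (hw : T.IsWellPlaced) (hw' : T'.IsWellPlaced) (p : V.Pos) :
    ¬ (T'.comp T).MeetsPartOfHole ((T'.comp T).face (.inl (T.lower p))) := by
  have hf := comp_face hT hT' hw hw'
  rintro ⟨d | d, -, hd, -, h, -⟩
  · have hd := ((comp_left hT hT' hw hw').isBoundary d).1 hd
    obtain ⟨q, hq, -⟩ := hT.exists_lower_of_face_eq hw hd.1 ((hf.inl_inl _ _).1 h).symm
    exact hd.2 ⟨q, hq.symm⟩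
  · have hd := ((comp_right hT hT' hw hw').isBoundary d).1 hd
    obtain ⟨r, -, hr⟩ := (hf.inl_inr _ _).1 h.symm
    obtain ⟨q, hq, -⟩ := hT'.exists_upper_of_face_eq hw' hd.1 hr.symm
    exact hd.2 ⟨q, hq.symm⟩

theorem comp_forbidden (hT : T.IsTangle) (hT' : T'.IsTangle)
    (hl : IsPart T (T'.comp T) Sum.inl (Set.range T.lower))
    (hr : IsPart T' (T'.comp T) Sum.inr (Set.range T'.upper)) (σ : (T'.comp T).Face → C) :
    (T'.comp T).IsForbidden W σ ↔
      T'.IsForbidden W (σ ∘ hr.faceMap) ∨ T.IsForbidden W (σ ∘ hl.faceMap) := by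
  constructor
  · rintro ⟨d | d, hd, h⟩
    · have hd := (hl.strand d).1 hd
      rw [hl.opp d (hl.notMem_of_strand hT hd)] at h
      exact .inr ⟨d, hd, h⟩
    · have hd := (hr.strand d).1 hd
      rw [hr.opp d (hr.notMem_of_strand hT' hd)] at h
      exact .inl ⟨d, hd, h⟩
  · rintro (⟨d, hd, h⟩ | ⟨d, hd, h⟩)
    · refine ⟨.inr d, (hr.strand d).2 hd, ?_⟩
      rw [hr.opp d (hr.notMem_of_strand hT' hd)]
      exact h
    · refine ⟨.inl d, (hl.strand d).2 hd, ?_⟩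
      rw [hl.opp d (hl.notMem_of_strand hT hd)]
      exact h

variable [Fintype D] [Fintype D']

theorem comp_eulerChar_left (hT : T.IsTangle) (hT' : T'.IsTangle)
    (hw : T.IsWellPlaced) (hw' : T'.IsWellPlaced) {d : D}
    (hd : ∀ p, T.face d ≠ T.face (T.lower p)) :
    (T'.comp T).cutOpen.eulerChar ((T'.comp T).face (.inl d)) =
      T.cutOpen.eulerChar (T.face d) := by
  have hg := gluable_cutOpen hT hT'
  have := hg.eulerChar_left
    (hg.component (face_lower_eq_iff_face_upper_eq hT hT' hw hw')) hd
  rw [← comp_cutOpen hT hT'] at this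
  exact this

theorem comp_eulerChar_right (hT : T.IsTangle) (hT' : T'.IsTangle)
    (hw : T.IsWellPlaced) (hw' : T'.IsWellPlaced) {d : D'}
    (hd : ∀ p, T'.face d ≠ T'.face (T'.upper p)) :
    (T'.comp T).cutOpen.eulerChar ((T'.comp T).face (.inr d)) =
      T'.cutOpen.eulerChar (T'.face d) := by
  have hg := gluable_cutOpen hT hT'
  have := hg.eulerChar_right
    (hg.component (face_lower_eq_iff_face_upper_eq hT hT' hw hw')) hd
  rw [← comp_cutOpen hT hT'] at this
  exact this

open Classical in
/-- Pasting two faces along a segment lowers the sum of the Euler characteristics by one; pasting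
them along a whole hole preserves it. -/
theorem comp_eulerChar_glued (hT : T.IsTangle) (hT' : T'.IsTangle)
    (hw : T.IsWellPlaced) (hw' : T'.IsWellPlaced) (p : V.Pos) :
    (T'.comp T).cutOpen.eulerChar ((T'.comp T).face (.inl (T.lower p))) =
      T.cutOpen.eulerChar (T.face (T.lower p)) + T'.cutOpen.eulerChar (T'.face (T'.upper p)) -
        if ∃ j, V.endpoint p.1 j then 1 else 0 := by
  have hg := gluable_cutOpen hT hT'
  have hc := face_lower_eq_iff_face_upper_eq hT hT' hw hw'
  have h₁ := hg.eulerChar_glued (hg.component hc) hc p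
  rw [← comp_cutOpen hT hT'] at h₁
  have h₂ : {q | T.cutOpen.component (T.lower q) = T.cutOpen.component (T.lower p) ∧
      ∀ r, T.cutOpen.head (T.lower q) ≠ T.cutOpen.tail (T.lower r)} =
      {q | V.arc q = V.arc p ∧ V.endpoint (V.succ q).1 (V.succ q).2} := by
    ext q
    refine and_congr (hT.face_lower_eq_iff hw) ?_
    simp [hT.lower_adjacent_cutOpen]
  rw [h₂, BoundaryType.ncard_last] at h₁
  refine h₁.trans ?_
  push_cast
  rfl

/-- If two faces are pasted along a segment, then the two square roots make up for the change of
the Euler characteristic. -/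
theorem comp_contribution_glued (hT : T.IsTangle) (hT' : T'.IsTangle)
    (hw : T.IsWellPlaced) (hw' : T'.IsWellPlaced) (p : V.Pos) (i : C) :
    (T'.comp T).contribution W ((T'.comp T).face (.inl (T.lower p))) i =
      T'.contribution W (T'.face (T'.upper p)) i * T.contribution W (T.face (T.lower p)) i := by
  rw [contribution, if_neg (comp_not_meetsPartOfHole_glued hT hT' hw hw' p),
    comp_eulerChar_glued hT hT' hw hw']
  have h₁ := hT.meetsPartOfHole_lower hw p
  have h₂ := hT'.meetsPartOfHole_upper hw' p
  by_cases hp : ∃ j, V.endpoint p.1 j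
  · rw [contribution, contribution, if_pos hp, if_pos (h₁.2 hp), if_pos (h₂.2 hp), ← Units.val_mul,
      div_mul_div_comm, ← pow_two, W.sqrt_sq, ← zpow_add, zpow_sub_one, ← div_eq_mul_inv, add_comm]
  · rw [contribution, contribution, if_neg hp, if_neg (h₁.not.2 hp), if_neg (h₂.not.2 hp),
      ← Units.val_mul, ← zpow_add, sub_zero, add_comm]

/-- The faces of `T` and those of `T'` are distributed over the faces of the composite: each of these
is the image of one face of `T`, of one face of `T'`, or of one of each. -/
theorem prod_contribution_comp (hT : T.IsTangle) (hT' : T'.IsTangle)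
    (hw : T.IsWellPlaced) (hw' : T'.IsWellPlaced)
    (hl : IsPart T (T'.comp T) Sum.inl (Set.range T.lower))
    (hr : IsPart T' (T'.comp T) Sum.inr (Set.range T'.upper)) (σ : (T'.comp T).Face → C) :
    ∏ f, (T'.comp T).contribution W f (σ f) =
      (∏ f, T'.contribution W f (σ (hr.faceMap f))) *
        ∏ f, T.contribution W f (σ (hl.faceMap f)) := by
  classical
  have hf := comp_face hT hT' hw hw'
  have fiber_left : ∀ f, ({g | hl.faceMap g = hl.faceMap f} : Finset T.Face) = {f} := fun f => by
    ext g; simp [hl.faceMap_injective.eq_iff]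
  have fiber_right : ∀ f, ({g | hr.faceMap g = hr.faceMap f} : Finset T'.Face) = {f} := fun f => by
    ext g; simp [hr.faceMap_injective.eq_iff]
  rw [← Finset.prod_fiberwise Finset.univ hr.faceMap fun f => T'.contribution W f _,
    ← Finset.prod_fiberwise Finset.univ hl.faceMap fun f => T.contribution W f _,
    ← Finset.prod_mul_distrib]
  refine Finset.prod_congr rfl fun F _ => ?_
  obtain ⟨x, rfl⟩ : ∃ x, (T'.comp T).face x = F := Quotient.exists_rep F
  have glued : ∀ p, (T'.comp T).contribution W ((T'.comp T).face (.inl (T.lower p)))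
      (σ ((T'.comp T).face (.inl (T.lower p)))) =
      (∏ g with hr.faceMap g = (T'.comp T).face (.inl (T.lower p)),
        T'.contribution W g (σ (hr.faceMap g))) *
      ∏ g with hl.faceMap g = (T'.comp T).face (.inl (T.lower p)),
        T.contribution W g (σ (hl.faceMap g)) := by
    intro p
    have h₁ : (T'.comp T).face (.inl (T.lower p)) = hl.faceMap (T.face (T.lower p)) := rfl
    have h₂ : (T'.comp T).face (.inl (T.lower p)) = hr.faceMap (T'.face (T'.upper p)) :=
      (hf.inl_inr _ _).2 ⟨p, rfl, rfl⟩
    rw [comp_contribution_glued hT hT' hw hw']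
    congr 1
    · rw [h₂, fiber_right, Finset.prod_singleton]
    · rw [h₁, fiber_left, Finset.prod_singleton]
  rcases x with d | d
  · by_cases hd : ∃ p, T.face d = T.face (T.lower p)
    · obtain ⟨p, hp⟩ := hd
      rw [(hf.inl_inl _ _).2 hp]
      exact glued p
    · push Not at hd
      have h₁ : (T'.comp T).face (.inl d) = hl.faceMap (T.face d) := rfl
      have h₂ : ({g | hr.faceMap g = (T'.comp T).face (.inl d)} : Finset T'.Face) = ∅ := by
        refine Finset.filter_eq_empty_iff.2 fun g _ hg => ?_
        obtain ⟨e, rfl⟩ : ∃ e, T'.face e = g := Quotient.exists_rep g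
        obtain ⟨p, hp, -⟩ := (hf.inl_inr _ _).1 hg.symm
        exact hd p hp
      rw [h₂, Finset.prod_empty, one_mul, h₁, fiber_left, Finset.prod_singleton]
      refine contribution_congr (hl.meetsPartOfHole ?_) (comp_eulerChar_left hT hT' hw hw' hd) _
      rintro _ ⟨p, rfl⟩
      exact hd p
  · by_cases hd : ∃ p, T'.face d = T'.face (T'.upper p)
    · obtain ⟨p, hp⟩ := hd
      rw [← (hf.inl_inr (T.lower p) d).2 ⟨p, rfl, hp⟩]
      exact glued p
    · push Not at hd
      have h₁ : (T'.comp T).face (.inr d) = hr.faceMap (T'.face d) := rfl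
      have h₂ : ({g | hl.faceMap g = (T'.comp T).face (.inr d)} : Finset T.Face) = ∅ := by
        refine Finset.filter_eq_empty_iff.2 fun g _ hg => ?_
        obtain ⟨e, rfl⟩ : ∃ e, T.face e = g := Quotient.exists_rep g
        obtain ⟨p, -, hp⟩ := (hf.inl_inr _ _).1 hg
        exact hd p hp
      rw [h₂, Finset.prod_empty, mul_one, h₁, fiber_right, Finset.prod_singleton]
      refine contribution_congr (hr.meetsPartOfHole ?_) (comp_eulerChar_right hT hT' hw hw' hd) _
      rintro _ ⟨p, rfl⟩
      exact hd p

open Classical in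
theorem crossings_comp (hT : T.IsTangle) (hT' : T'.IsTangle)
    (hw : T.IsWellPlaced) (hw' : T'.IsWellPlaced) :
    (T'.comp T).crossings =
      T'.crossings.image (Sym2.map Sum.inr) ∪ T.crossings.image (Sym2.map Sum.inl) := by
  have hl := comp_left hT hT' hw hw'
  have hr := comp_right hT hT' hw hw'
  -- No crossing lies on a pasted hole.
  have left : ∀ d, (T'.comp T).degree ((T'.comp T).surface.tail (.inl d)) = 4 →
      ∀ b ∈ Set.range T.lower, T.surface.tail d ≠ T.surface.tail b := fun d hd => by
    refine (comp_tail_inl_cases hT hT' d).resolve_left ?_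
    rintro ⟨p, hp⟩
    have := degree_glued hT hT' p
    rw [hp] at hd
    omega
  have right : ∀ d, (T'.comp T).degree ((T'.comp T).surface.tail (.inr d)) = 4 →
      ∀ b ∈ Set.range T'.upper, T'.surface.tail d ≠ T'.surface.tail b := fun d hd => by
    refine (comp_tail_inr_cases hT hT' d).resolve_left ?_
    rintro ⟨p, hp⟩
    have := degree_glued hT hT' p
    rw [hp] at hd
    omega
  have memL : ∀ d, .inl d ∈ (T'.comp T).strand ∩ (T'.comp T).overpass ↔
      d ∈ T.strand ∩ T.overpass := fun d => and_congr (hl.strand d) (hl.overpass d)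
  have memR : ∀ d, .inr d ∈ (T'.comp T).strand ∩ (T'.comp T).overpass ↔
      d ∈ T'.strand ∩ T'.overpass := fun d => and_congr (hr.strand d) (hr.overpass d)
  ext z
  simp only [Finset.mem_union, Finset.mem_image, mem_crossings]
  constructor
  · rintro ⟨d | d, e | e, rfl, hne, hde, h4, hd, he⟩
    · refine .inr ⟨s(d, e), ⟨d, e, rfl, fun h => hne (congr_arg _ h), (hl.tail _ _).1 hde, ?_,
        (memL d).1 hd, (memL e).1 he⟩, rfl⟩
      rwa [← hl.degree_eq (left d h4)]
    · obtain ⟨b, hb, hdb⟩ := hl.tail_outside d (.inr e) (by simp) hde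
      exact absurd hdb (left d h4 b hb)
    · obtain ⟨b, hb, hdb⟩ := hr.tail_outside d (.inl e) (by simp) hde
      exact absurd hdb (right d h4 b hb)
    · refine .inl ⟨s(d, e), ⟨d, e, rfl, fun h => hne (congr_arg _ h), (hr.tail _ _).1 hde, ?_,
        (memR d).1 hd, (memR e).1 he⟩, rfl⟩
      rwa [← hr.degree_eq (right d h4)]
  · rintro (⟨_, ⟨d, e, rfl, hne, hde, h4, hd, he⟩, rfl⟩ | ⟨_, ⟨d, e, rfl, hne, hde, h4, hd, he⟩, rfl⟩)
    · refine ⟨.inr d, .inr e, rfl, by simpa using hne, (hr.tail _ _).2 hde, ?_, (memR d).2 hd,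
        (memR e).2 he⟩
      rwa [hr.degree_eq]
      rintro _ ⟨p, rfl⟩ hdp
      have := hT'.degree_boundary _ (hT'.upper_boundary p)
      rw [← hdp] at this
      omega
    · refine ⟨.inl d, .inl e, rfl, by simpa using hne, (hl.tail _ _).2 hde, ?_, (memL d).2 hd,
        (memL e).2 he⟩
      rwa [hl.degree_eq]
      rintro _ ⟨p, rfl⟩ hdp
      have := hT.degree_boundary _ (hT.lower_boundary p)
      rw [← hdp] at this
      omega

theorem prod_crossingValue_comp (hT : T.IsTangle) (hT' : T'.IsTangle)
    (hw : T.IsWellPlaced) (hw' : T'.IsWellPlaced)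
    (hl : IsPart T (T'.comp T) Sum.inl (Set.range T.lower))
    (hr : IsPart T' (T'.comp T) Sum.inr (Set.range T'.upper)) (σ : (T'.comp T).Face → C) :
    ∏ z ∈ (T'.comp T).crossings, (T'.comp T).crossingValue W σ z =
      (∏ z ∈ T'.crossings, T'.crossingValue W (σ ∘ hr.faceMap) z) *
        ∏ z ∈ T.crossings, T.crossingValue W (σ ∘ hl.faceMap) z := by
  classical
  rw [crossings_comp hT hT' hw hw', Finset.prod_union, Finset.prod_image, Finset.prod_image]
  · exact congr_arg₂ _ (Finset.prod_congr rfl fun z hz => hr.crossingValue_map hT' σ hz)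
      (Finset.prod_congr rfl fun z hz => hl.crossingValue_map hT σ hz)
  · exact (Sym2.map.injective Sum.inl_injective).injOn
  · exact (Sym2.map.injective Sum.inr_injective).injOn
  · rw [Finset.disjoint_left]
    intro z hz hz'
    obtain ⟨x, -, rfl⟩ := Finset.mem_image.1 hz
    obtain ⟨y, -, hxy⟩ := Finset.mem_image.1 hz'
    induction x with
    | _ a b => induction y with
      | _ c d => simp at hxy

/-- The value of a state of a composite is the product of the values of its restrictions. -/
theorem stateValue_comp (hT : T.IsTangle) (hT' : T'.IsTangle)
    (hw : T.IsWellPlaced) (hw' : T'.IsWellPlaced)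
    (hl : IsPart T (T'.comp T) Sum.inl (Set.range T.lower))
    (hr : IsPart T' (T'.comp T) Sum.inr (Set.range T'.upper)) (σ : (T'.comp T).Face → C) :
    (T'.comp T).stateValue W σ =
      T'.stateValue W (σ ∘ hr.faceMap) * T.stateValue W (σ ∘ hl.faceMap) := by
  have hf := comp_forbidden (W := W) hT hT' hl hr σ
  by_cases h₁ : T'.IsForbidden W (σ ∘ hr.faceMap)
  · rw [stateValue, if_pos (hf.2 (.inl h₁)), stateValue, if_pos h₁, zero_mul]
  · by_cases h₂ : T.IsForbidden W (σ ∘ hl.faceMap)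
    · rw [stateValue, if_pos (hf.2 (.inr h₂)), stateValue.eq_def T, if_pos h₂, mul_zero]
    · rw [stateValue, if_neg (fun h => (hf.1 h).elim h₁ h₂), stateValue, if_neg h₁, stateValue,
        if_neg h₂, prod_contribution_comp hT hT' hw hw' hl hr,
        prod_crossingValue_comp hT hT' hw hw' hl hr, map_mul]
      exact mul_mul_mul_comm _ _ _ _

/-! ### The evaluation of composites -/

/-- The states of a composite are the pairs of states that agree along the pasted edges. -/
theorem sum_states_comp [Fintype C] {Y : Type*} [AddCommMonoid Y] (hT : T.IsTangle)
    (hT' : T'.IsTangle) (hw : T.IsWellPlaced) (hw' : T'.IsWellPlaced)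
    (hl : IsPart T (T'.comp T) Sum.inl (Set.range T.lower))
    (hr : IsPart T' (T'.comp T) Sum.inr (Set.range T'.upper))
    [DecidableEq T.Face] [DecidableEq T'.Face] [DecidableEq (T'.comp T).Face]
    [DecidablePred fun s : (T'.Face → C) × (T.Face → C) =>
      ∀ p, s.1 (T'.face (T'.upper p)) = s.2 (T.face (T.lower p))]
    (g : (T'.Face → C) → (T.Face → C) → Y) :
    ∑ σ : (T'.comp T).Face → C, g (σ ∘ hr.faceMap) (σ ∘ hl.faceMap) =
      ∑ s : (T'.Face → C) × (T.Face → C) with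
        ∀ p, s.1 (T'.face (T'.upper p)) = s.2 (T.face (T.lower p)), g s.1 s.2 := by
  have hf := comp_face hT hT' hw hw'
  refine Finset.sum_bij (fun σ _ => (σ ∘ hr.faceMap, σ ∘ hl.faceMap)) ?_ ?_ ?_ fun _ _ => rfl
  · intro σ _
    rw [Finset.mem_filter_univ]
    exact fun p => congr_arg σ ((hf.inl_inr _ _).2 ⟨p, rfl, rfl⟩).symm
  · intro σ _ τ _ h
    rw [Prod.mk.injEq] at h
    funext F
    obtain ⟨d | d, rfl⟩ : ∃ x, (T'.comp T).face x = F := Quotient.exists_rep F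
    · exact congr_fun h.2 (T.face d)
    · exact congr_fun h.1 (T'.face d)
  · rintro ⟨σ', σ⟩ hσ
    rw [Finset.mem_filter_univ] at hσ
    have key : ∀ d e, (T'.comp T).face (.inl d) = (T'.comp T).face (.inr e) →
        σ (T.face d) = σ' (T'.face e) := by
      intro d e h
      obtain ⟨p, hd, he⟩ := (hf.inl_inr d e).1 h
      rw [hd, he]
      exact (hσ p).symm
    refine ⟨Quotient.lift (Sum.elim (fun d => σ (T.face d)) fun d => σ' (T'.face d)) ?_,
      Finset.mem_univ _, Prod.ext ?_ ?_⟩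
    · intro x y hxy
      replace hxy : (T'.comp T).face x = (T'.comp T).face y := Quotient.sound hxy
      rcases x with x | x <;> rcases y with y | y
      · exact congr_arg σ ((hf.inl_inl _ _).1 hxy)
      · exact key _ _ hxy
      · exact (key _ _ hxy.symm).symm
      · exact congr_arg σ' ((hf.inr_inr _ _).1 hxy)
    · funext f
      obtain ⟨d, rfl⟩ : ∃ d, T'.face d = f := Quotient.exists_rep f
      rfl
    · funext f
      obtain ⟨d, rfl⟩ : ∃ d, T.face d = f := Quotient.exists_rep f
      rfl

theorem evaluation_comp [Fintype C] [DecidableEq C] (hT : T.IsTangle) (hT' : T'.IsTangle)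
    (hw : T.IsWellPlaced) (hw' : T'.IsWellPlaced) :
    (T'.comp T).evaluation W = T'.evaluation W * T.evaluation W := by
  classical
  have hl := comp_left hT hT' hw hw'
  have hr := comp_right hT hT' hw hw'
  ext lam ups
  have h₁ := sum_states_comp (C := C) hT hT' hw hw' hl hr fun σ' σ =>
    if (∀ p, σ' (T'.face (T'.lower p)) = lam p) ∧ (∀ p, σ (T.face (T.upper p)) = ups p) then
      T'.stateValue W σ' * T.stateValue W σ else 0
  have h₂ : (T'.comp T).evaluation W lam ups = ∑ σ : (T'.comp T).Face → C,
      if (∀ p, (σ ∘ hr.faceMap) (T'.face (T'.lower p)) = lam p) ∧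
        (∀ p, (σ ∘ hl.faceMap) (T.face (T.upper p)) = ups p) then
      T'.stateValue W (σ ∘ hr.faceMap) * T.stateValue W (σ ∘ hl.faceMap) else 0 := by
    unfold evaluation
    refine Finset.sum_congr (by congr!) fun σ _ => ?_
    rw [stateValue_comp hT hT' hw hw' hl hr]
    congr!
  rw [h₂, h₁, Matrix.mul_apply, Finset.sum_filter, Fintype.sum_prod_type]
  simp only [evaluation, Finset.sum_mul_sum]
  conv_rhs => rw [Finset.sum_comm]
  refine Finset.sum_congr rfl fun σ' _ => ?_
  rw [Finset.sum_comm]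
  refine Finset.sum_congr rfl fun σ _ => ?_
  -- Only the list of symbols that `σ'` has along the pasted edges contributes.
  rw [Finset.sum_eq_single fun p => σ' (T'.face (T'.upper p))]
  · by_cases hσ : ∀ p, σ' (T'.face (T'.upper p)) = σ (T.face (T.lower p))
    · have hσ' : ∀ p, σ (T.face (T.lower p)) = σ' (T'.face (T'.upper p)) := fun p => (hσ p).symm
      rw [if_pos hσ]
      simp only [hσ', implies_true, and_true, true_and, ite_and, ite_mul, mul_ite, zero_mul,
        mul_zero]
      split_ifs <;> rfl
    · have hσ' : ¬ ∀ p, σ (T.face (T.lower p)) = σ' (T'.face (T'.upper p)) :=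
        fun h => hσ fun p => (h p).symm
      rw [if_neg hσ]
      exact (mul_eq_zero_of_right _ (if_neg fun h => hσ' h.1)).symm
  · intro mid _ hmid
    rw [if_neg fun h => hmid (funext fun p => (h.2 p).symm), zero_mul]
  · exact fun h => absurd (Finset.mem_univ _) h

end DecoratedTangle

end FacialTangle

/-- The last clause is the product of the matrices indexed by all lists of symbols.  The one before
it is the product of the matrices restricted to admissible partial states. -/
theorem mainTheorem2 {U V L : FacialTangle.BoundaryType} {D D' : Type*} [Fintype D] [Fintype D']
    {C R A : Type*} [Fintype C] [DecidableEq C] [CommRing R] [CommRing A] [Algebra R A]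
    (W : FacialTangle.FacialVariables C R A)
    (T : FacialTangle.DecoratedTangle U V D) (T' : FacialTangle.DecoratedTangle V L D')
    (hT : T.IsTangle) (hT' : T'.IsTangle)
    (hw : T.IsWellPlaced) (hw' : T'.IsWellPlaced) :
    (T'.comp T).IsTangle ∧ (T'.comp T).IsWellPlaced ∧
    (T'.comp T).lowerStates W = T'.lowerStates W ∧
    (T'.comp T).upperStates W = T.upperStates W ∧
    (∀ lam ∈ T'.lowerStates W, ∀ ups ∈ T.upperStates W,
      (T'.comp T).evaluation W lam ups =
        ∑ mid ∈ T'.upperStates W ∩ T.lowerStates W,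
          T'.evaluation W lam mid * T.evaluation W mid ups) ∧
    (T'.comp T).evaluation W = T'.evaluation W * T.evaluation W := by
  have hev := FacialTangle.DecoratedTangle.evaluation_comp (W := W) hT hT' hw hw'
  refine ⟨FacialTangle.DecoratedTangle.comp_isTangle hT hT' hw hw',
    FacialTangle.DecoratedTangle.comp_isWellPlaced hT hT' hw hw', ?_, ?_, ?_, hev⟩
  · ext c
    simp only [FacialTangle.DecoratedTangle.lowerStates, Finset.mem_filter_univ]
    refine (FacialTangle.DecoratedTangle.comp_right hT hT' hw hw').isAdmissible hT' ?_
    rintro p _ ⟨q, rfl⟩ h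
    exact hT'.face_upper_ne_lower hw' q p h.symm
  · ext c
    simp only [FacialTangle.DecoratedTangle.upperStates, Finset.mem_filter_univ]
    refine (FacialTangle.DecoratedTangle.comp_left hT hT' hw hw').isAdmissible hT ?_
    rintro p _ ⟨q, rfl⟩ h
    exact hT.face_upper_ne_lower hw p q h
  · intro lam _ ups _
    rw [hev, Matrix.mul_apply]
    refine (Finset.sum_subset (Finset.subset_univ _) fun mid _ hmid => ?_).symm
    rw [Finset.mem_inter, not_and_or] at hmid
    obtain h | h := hmid
    · rw [FacialTangle.DecoratedTangle.evaluation_eq_zero_of_notMem_upperStates h, zero_mul]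
    · rw [FacialTangle.DecoratedTangle.evaluation_eq_zero_of_notMem_lowerStates h, mul_zero]
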